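/- Let $K$ be a number field and $G$ a finite group. For $e\ge 1$ let $\mu_e$ be the group of $e$-th roots of unity in $\overline K$ and $U_e=\mathrm{Gal}(K(\mu_e)|K)$. Consider the set of pairs $(I,\gamma)$, where $I\subseteq G$ is a cyclic subgroup of size $e$ and $\gamma\colon I\to\mu_e$ is a group isomorphism. The group $G$ acts on it by $g.(I,\gamma)=(gIg^{-1},\gamma')$ with $\gamma'(ghg^{-1})=\gamma(h)$, and $U_e$ acts on it by $\sigma.(I,\gamma)=(I,\sigma\circ\gamma)$; these actions commute. A ramification type is an orbit $[I,\gamma]$ of the combined action of $G\times U_e$. Let $\mathfrak p$ be a nonzero prime ideal of $\mathcal O_K$ with completion $K_{\mathfrak p}$. Let $f\colon\mathrm{Gal}(\overline{K_{\mathfrak p}}|K_{\mathfrak p})\to G$ be a continuous homomorphism, let $I_f\subseteq G$ be the image of the inertia group, let $e=\#I_f$, and assume that $\mathfrak p\nmid e$ (that is, $f$ is at most tamely ramified). Let $L$ be the fixed field of $\ker f$, let $\pi$ be a uniformizer of $L$, and choose a $K$-embedding $\iota\colon K(\mu_e)\to\overline{K_{\mathfrak p}}$. Then for each $g=f(\sigma)\in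 I_f$, with $\sigma$ in the inertia group, there is a unique $\gamma_f(g)\in\mu_e$ such that $\iota(\gamma_f(g))\equiv\sigma(\pi)/\pi$ modulo the maximal ideal of the ring of integers of $\overline{K_{\mathfrak p}}$. The class $[I_f,\gamma_f]$, which does not depend on the choices, is called the ramification type of $f$. Let $(I,\gamma)$ be a pair as above with $\#I=e$, and assume that $\mathfrak p\nmid e$. Let $A\subseteq U_e$ be the stabilizer of the $G$-orbit of $(I,\gamma)$ under the action of $U_e$ on the set of $G$-orbits of pairs, and let $\mathrm{Frob}(\mathfrak p)\in U_e$ be the Frobenius automorphism of $\mathfrak p$ in $K(\mu_e)|K$. Then there are only finitely many continuous homomorphisms $f\colon\mathrm{Gal}(\overline{K_{\mathfrak p}}|K_{\mathfrak p})\to G$ of ramification type $[I,\gamma]$, and $$\frac1{\#G}\cdot\#\{f\colon\mathrm{Gal}(\overline{K_{\mathfrak p}}|K_{\mathfrak p})\to G\text{ of ramification type }[I,\gamma]\}=\begin{cases}[U_e:A]&\text{if }\mathrm{Frob}(\mathfrak p)\in A,\\0&\text{otherwise.}\end{cases}$$ -/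

import Mathlib

open NumberField IsDedekindDomain

/-- For a complete nonarchimedean field, the integral closure of its valuation ring in an algebraic
extension is the closed unit ball of the spectral norm. -/
theorem mem_integralClosure_iff_spectralNorm_le_one {F : Type*} [NontriviallyNormedField F]
    [IsUltrametricDist F] (A : ValuationSubring F) (hA : ∀ x, x ∈ A ↔ ‖x‖ ≤ 1)
    {L : Type*} [Field L] [Algebra F L] [Algebra.IsAlgebraic F L] (x : L) :
    x ∈ integralClosure A L ↔ spectralNorm F L x ≤ 1 := by
  have hx : IsIntegral F x := Algebra.IsIntegral.isIntegral x
  rw [spectralNorm, spectralValue_le_one_iff (minpoly.monic hx)]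
  constructor
  · intro h n
    rw [minpoly.isIntegrallyClosed_eq_field_fractions' F h, Polynomial.coeff_map]
    exact (hA _).1 ((minpoly A x).coeff n).2
  · intro h
    have hl : minpoly F x ∈ Polynomial.lifts (algebraMap A F) := by
      rw [Polynomial.lifts_iff_coeff_lifts]
      exact fun n => ⟨⟨_, (hA _).2 (h n)⟩, rfl⟩
    obtain ⟨q, hq, -, hm⟩ := Polynomial.lifts_and_degree_eq_and_monic hl (minpoly.monic hx)
    refine ⟨q, hm, ?_⟩
    have h0 : Polynomial.aeval x (q.map (algebraMap A F)) = 0 := by rw [hq]; exact minpoly.aeval F x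
    rwa [Polynomial.aeval_map_algebraMap] at h0

/-- For a complete nonarchimedean field, the integral closure of its valuation ring in an algebraic
extension is a local ring. -/
theorem isLocalRing_integralClosure {F : Type*} [NontriviallyNormedField F]
    [IsUltrametricDist F] [CompleteSpace F] (A : ValuationSubring F) (hA : ∀ x, x ∈ A ↔ ‖x‖ ≤ 1)
    (L : Type*) [Field L] [Algebra F L] [Algebra.IsAlgebraic F L] :
    IsLocalRing (integralClosure A L) := by
  have key := mem_integralClosure_iff_spectralNorm_le_one A hA (L := L)
  have hmul : ∀ x y : L, spectralNorm F L (x * y) = spectralNorm F L x * spectralNorm F L y :=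
    fun x y => spectralAlgNorm_mul x y
  have h_one : spectralNorm F L 1 = 1 := spectralNorm_one
  have unit_iff : ∀ b : integralClosure A L, IsUnit b ↔ spectralNorm F L (b : L) = 1 := by
    intro b
    have hb := (key b).1 b.2
    constructor
    · rintro hu
      obtain ⟨c, hc⟩ := hu.exists_right_inv
      have h1 : spectralNorm F L (b : L) * spectralNorm F L (c : L) = 1 := by
        have hc1 : (b : L) * (c : L) = 1 := congrArg Subtype.val hc
        rw [← hmul, hc1, h_one]
      have hc' := (key c).1 c.2
      have h0 := spectralNorm_nonneg (K := F) (b : L)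
      exact le_antisymm hb (h1 ▸ mul_le_of_le_one_right h0 hc')
    · intro h
      have hne : (b : L) ≠ 0 := by
        intro h0
        rw [h0, spectralNorm_zero] at h
        exact zero_ne_one h
      have hinv : spectralNorm F L ((b : L)⁻¹) = 1 := by
        have := hmul (b : L) (b : L)⁻¹
        rw [mul_inv_cancel₀ hne, h, one_mul, h_one] at this
        exact this.symm
      exact IsUnit.of_mul_eq_one ⟨(b : L)⁻¹, (key _).2 hinv.le⟩
        (Subtype.ext (mul_inv_cancel₀ hne))
  refine IsLocalRing.of_nonunits_add fun a b ha hb => ?_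
  rw [mem_nonunits_iff, unit_iff] at ha hb ⊢
  have ha' := lt_of_le_of_ne ((key a).1 a.2) ha
  have hb' := lt_of_le_of_ne ((key b).1 b.2) hb
  refine ne_of_lt (lt_of_le_of_lt ?_ (max_lt ha' hb'))
  exact isNonarchimedean_spectralNorm (a : L) (b : L)

section Global

variable (K : Type*) [Field K] (G : Type*) [Group G] (e : ℕ)

/-- The pairs `(I, γ)` where `I` is a cyclic subgroup of `G` of size `e` and `γ` is an isomorphism
from `I` to the group `μ_e` of `e`-th roots of unity in `K(μ_e)`. -/
structure InertiaPair where
  I : Subgroup G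
  isCyclic : IsCyclic I
  card_eq : Nat.card I = e
  γ : I ≃* rootsOfUnity e (CyclotomicField e K)

variable {K G e}

namespace InertiaPair

theorem ext' {x y : InertiaPair K G e} (hI : x.I = y.I)
    (hγ : ∀ (g : G) (hx : g ∈ x.I) (hy : g ∈ y.I), x.γ ⟨g, hx⟩ = y.γ ⟨g, hy⟩) : x = y := by
  obtain ⟨I, c, h, γ⟩ := x
  obtain ⟨J, d, k, δ⟩ := y
  obtain rfl : I = J := hI
  obtain rfl : γ = δ := MulEquiv.ext fun g => hγ g g.2 g.2
  rfl

/-- The conjugate `g.(I, γ) = (gIg⁻¹, γ')` with `γ'(ghg⁻¹) = γ(h)`. -/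
noncomputable def conj (g : G) (x : InertiaPair K G e) : InertiaPair K G e where
  I := x.I.map (MulAut.conj g).toMonoidHom
  isCyclic := ((MulAut.conj g).subgroupMap x.I).isCyclic.1 x.isCyclic
  card_eq := (Nat.card_congr ((MulAut.conj g).subgroupMap x.I).toEquiv).symm.trans x.card_eq
  γ := ((MulAut.conj g).subgroupMap x.I).symm.trans x.γ

theorem conj_γ (g : G) (x : InertiaPair K G e) (h : x.I) (hh : g * h * g⁻¹ ∈ (conj g x).I) :
    (conj g x).γ ⟨g * h * g⁻¹, hh⟩ = x.γ h := by
  exact congrArg x.γ (((MulAut.conj g).subgroupMap x.I).symm_apply_apply h)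

theorem mem_conj_I (g : G) (x : InertiaPair K G e) (a : G) :
    a ∈ (conj g x).I ↔ ∃ h : x.I, a = g * h * g⁻¹ := by
  constructor
  · rintro ⟨h, hh, rfl⟩
    exact ⟨⟨h, hh⟩, rfl⟩
  · rintro ⟨h, rfl⟩
    exact ⟨h, h.2, rfl⟩

/-- `G` acts on the pairs by conjugation. -/
noncomputable instance : MulAction G (InertiaPair K G e) where
  smul := conj
  one_smul x := by
    have hI : (conj 1 x).I = x.I := by
      ext a; rw [mem_conj_I]; exact ⟨by rintro ⟨h, rfl⟩; simp, fun h => ⟨⟨a, h⟩, by simp⟩⟩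
    refine ext' hI fun a h1 h2 => ?_
    change (conj 1 x).γ ⟨a, h1⟩ = x.γ ⟨a, h2⟩
    have h3 : a = 1 * a * 1⁻¹ := by simp
    have h4 : 1 * a * 1⁻¹ ∈ (conj 1 x).I := h3 ▸ h1
    rw [← conj_γ 1 x ⟨a, h2⟩ h4]
    exact congrArg (conj 1 x).γ (Subtype.ext h3)
  mul_smul g k x := by
    have hI : (conj (g * k) x).I = (conj g (conj k x)).I := by
      ext a
      simp only [mem_conj_I]
      constructor
      · rintro ⟨h, rfl⟩
        exact ⟨⟨k * h * k⁻¹, (mem_conj_I _ _ _).2 ⟨h, rfl⟩⟩, by simp [mul_assoc]⟩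
      · rintro ⟨⟨h, hh⟩, rfl⟩
        obtain ⟨h', rfl⟩ := (mem_conj_I _ _ _).1 hh
        exact ⟨h', by simp [mul_assoc]⟩
    refine ext' hI fun a h1 h2 => ?_
    change (conj (g * k) x).γ _ = (conj g (conj k x)).γ _
    obtain ⟨h, rfl⟩ := (mem_conj_I _ _ _).1 h1
    have hk : k * h * k⁻¹ ∈ (conj k x).I := (mem_conj_I _ _ _).2 ⟨h, rfl⟩
    have e1 := conj_γ (g * k) x h h1
    have e2 := conj_γ g (conj k x) ⟨k * h * k⁻¹, hk⟩ ((mem_conj_I _ _ _).2 ⟨_, rfl⟩)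
    have e3 := conj_γ k x h hk
    rw [e1, ← e3, ← e2]
    congr 2
    simp [mul_assoc]

/-- `U_e = Gal(K(μ_e)|K)` acts on the pairs by `σ.(I, γ) = (I, σ ∘ γ)`. -/
noncomputable instance : MulAction Gal(CyclotomicField e K/K) (InertiaPair K G e) where
  smul σ x := { x with γ := x.γ.trans (σ.toRingEquiv.toMulEquiv.restrictRootsOfUnity e) }
  one_smul _ := rfl
  mul_smul _ _ _ := rfl

instance : SMulCommClass Gal(CyclotomicField e K/K) G (InertiaPair K G e) where
  smul_comm _ _ _ := rfl

instance : SMulCommClass G Gal(CyclotomicField e K/K) (InertiaPair K G e) where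
  smul_comm _ _ _ := rfl

/-- The combined action of `G × U_e` on the pairs. -/
noncomputable instance : MulAction (G × Gal(CyclotomicField e K/K)) (InertiaPair K G e) :=
  MulAction.prodOfSMulCommClass G Gal(CyclotomicField e K/K) (InertiaPair K G e)

/-- The action of `U_e` on the set of `G`-orbits of pairs. -/
noncomputable instance : MulAction Gal(CyclotomicField e K/K)
    (MulAction.orbitRel.Quotient G (InertiaPair K G e)) where
  smul σ := Quotient.map' (fun x => σ • x) (by
    rintro x y ⟨g, rfl⟩
    exact ⟨g, smul_comm g σ y⟩)
  one_smul q := Quotient.inductionOn' q fun x => congrArg Quotient.mk'' (one_smul _ x)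
  mul_smul σ τ q := Quotient.inductionOn' q fun x => congrArg Quotient.mk'' (mul_smul σ τ x)

/-- The stabilizer `A ⊆ U_e` of the `G`-orbit containing the given pair. -/
noncomputable def orbitStabilizer (x : InertiaPair K G e) : Subgroup Gal(CyclotomicField e K/K) :=
  MulAction.stabilizer Gal(CyclotomicField e K/K)
    (Quotient.mk'' x : MulAction.orbitRel.Quotient G (InertiaPair K G e))

end InertiaPair

variable (K G e) in
/-- Ramification types: orbits `[I, γ]` of pairs `(I, γ)` under the action of `G × U_e`. -/
abbrev RamificationType : Type _ :=
  MulAction.orbitRel.Quotient (G × Gal(CyclotomicField e K/K)) (InertiaPair K G e)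

/-- The ramification type `[I, γ]` of a pair `(I, γ)`. -/
noncomputable def InertiaPair.ramificationType (x : InertiaPair K G e) : RamificationType K G e :=
  Quotient.mk'' x

/-- `σ ∈ U_e = Gal(K(μ_e)|K)` is a Frobenius automorphism at the prime `v` of `K`: there is a prime
`P` of `K(μ_e)` above `v` with `σ(a) ≡ a ^ Nm(v)` modulo `P` for all integers `a` of `K(μ_e)`. -/
def IsFrobenius [NumberField K] (v : HeightOneSpectrum (𝓞 K)) (σ : Gal(CyclotomicField e K/K)) :
    Prop :=
  ∃ P : Ideal (𝓞 (CyclotomicField e K)), P.IsPrime ∧ P.LiesOver v.asIdeal ∧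
    ((galRestrict (𝓞 K) K (CyclotomicField e K) (𝓞 (CyclotomicField e K)) σ :
      𝓞 (CyclotomicField e K) ≃ₐ[𝓞 K] 𝓞 (CyclotomicField e K)) :
      𝓞 (CyclotomicField e K) →ₐ[𝓞 K] 𝓞 (CyclotomicField e K)).IsArithFrobAt P

end Global

section Local

variable {K : Type*} [Field K] [NumberField K] (v : HeightOneSpectrum (𝓞 K))

/-- The chosen algebraic closure of the completion `K_v`. -/
abbrev LocalClosure : Type _ := AlgebraicClosure (v.adicCompletion K)

/-- The absolute Galois group of `K_v`. -/
abbrev LocalGaloisGroup : Type _ := Gal(LocalClosure v/v.adicCompletion K)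

/-- The ring of integers of the algebraic closure of `K_v`. -/
abbrev LocalIntegers : Type _ := integralClosure (v.adicCompletionIntegers K) (LocalClosure v)

instance : IsLocalRing (LocalIntegers v) := by
  let : NontriviallyNormedField (v.adicCompletion K) :=
    Valued.toNontriviallyNormedField (v.adicCompletion K) (WithZero (Multiplicative ℤ))
  exact isLocalRing_integralClosure (v.adicCompletionIntegers K)
    (fun x => (HeightOneSpectrum.mem_adicCompletionIntegers (𝓞 K) K v).trans
      Valued.toNormedField.norm_le_one_iff.symm) (LocalClosure v)

/-- The inertia group of `K_v`: the automorphisms acting trivially modulo the maximal ideal of the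
ring of integers of the algebraic closure. -/
noncomputable def localInertia : Subgroup (LocalGaloisGroup v) :=
  (IsLocalRing.maximalIdeal (LocalIntegers v)).inertia (LocalGaloisGroup v)

variable {v} {G : Type*} [Group G] [TopologicalSpace G] {e : ℕ}

/-- The extension of `K_v` corresponding to a homomorphism `f`: the fixed field of its kernel. -/
noncomputable abbrev kernelField (f : LocalGaloisGroup v →ₜ* G) :
    IntermediateField (v.adicCompletion K) (LocalClosure v) :=
  IntermediateField.fixedField f.toMonoidHom.ker

/-- `f` is tamely ramified with inertia group `x.I` (of size `e` prime to the residue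
characteristic), and `x.γ(g) ≡ β(g)` for all `g` in `x.I`, where `β(f(σ)) = σ(π)/π` for `σ` in the
inertia group and `π` a uniformizer of the extension `L` of `K_v` cut out by `f` (the uniformizers
of the discrete valuation ring of integers of `L` being its irreducible elements). The embedding
`ι` of `K(μ_e)` determines a prime of `L(μ_e)`, namely the contraction of the maximal ideal. -/
def HasInertiaPair (f : LocalGaloisGroup v →ₜ* G)
    (ι : CyclotomicField e K →ₐ[K] LocalClosure v) (x : InertiaPair K G e) : Prop :=
  (e : 𝓞 K) ∉ v.asIdeal ∧
  x.I = (localInertia v).map f.toMonoidHom ∧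
  ∀ σ ∈ localInertia v, ∀ π : integralClosure (v.adicCompletionIntegers K) (kernelField f),
    Irreducible π → ∀ g : x.I, (g : G) = f σ →
      ∃ m ∈ IsLocalRing.maximalIdeal (LocalIntegers v),
        ι ((x.γ g : (CyclotomicField e K)ˣ) : CyclotomicField e K) -
          σ ((π : kernelField f) : LocalClosure v) / ((π : kernelField f) : LocalClosure v) =
            (m : LocalClosure v)

/-- The homomorphism `f` has ramification type `T`. -/
def HasRamificationType (f : LocalGaloisGroup v →ₜ* G) (T : RamificationType K G e) : Prop :=
  ∃ (ι : CyclotomicField e K →ₐ[K] LocalClosure v) (x : InertiaPair K G e),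
    HasInertiaPair f ι x ∧ x.ramificationType = T

end Local

/-!
Let `F = K_v`, let `Ω` be its algebraic closure with the extended valuation `w`, and let `q` be the
order of the residue field. The proof describes the tame quotient of `Gal(Ω/F)` by generators and
relations, and then counts pairs of group elements.

Fix a uniformizer `ϖ` of `F`, an `e`-th root `β` of `ϖ`, an embedding `ι` of `K(μ_e)` into `Ω` and
a Frobenius automorphism `s` of `Ω` with `s β = β` (`LocalValuation.exists_frobenius_fixing`).
An inertia automorphism `σ` fixes the roots of unity of order prime to the residue characteristic,
so it acts tamely through the `e`-th root of unity `σ β / β`. If `f` has an inertia group of order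
`e`, then the field cut out by `f` has ramification index `e`, and a uniformizer `π` of it has the
valuation of `β`; hence `σ π / π` is congruent to `σ β / β`. Thus `HasInertiaPair f ι (I, γ)` says
that `I` is the image of inertia and that `ι (γ (f σ)) = σ β / β` (`hasInertiaPair_iff`).

* A homomorphism `f` is determined by its inertia pair and by `b = f s`, because inertia and `s`
  generate a dense subgroup (`LocalValuation.eq_top_of_isClosed`, `HasInertiaPair.hom_ext`).
* Conjugation by `s` raises `σ β / β` to the `q`-th power, as does the Frobenius automorphism of
  `K(μ_e)`. So a pair `y = (I, γ)` and an element `b` belonging to the same `f` satisfy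
  `Frob • b • y = y` (`HasInertiaPair.frobenius_smul`).
* Conversely, each pair `(y, b)` with this property comes from a homomorphism
  (`exists_hasInertiaPair`). For a generator `a` of `I` the property says that `b a b⁻¹ = a ^ q`,
  and `σ ↦ a ^ i * b ^ d`, where `σ β = ζ ^ i β` and `σ` acts as the `q ^ d`-th power on a root of
  unity of sufficiently divisible order `q ^ n - 1`, is a well-defined homomorphism
  (`LocalValuation.exists_continuousMonoidHom`).

A change of `ι` moves `(I, γ)` within its orbit under `U_e`. So the homomorphisms of ramification
type `[I, γ]` correspond to the pairs `(y, b)` with `y` in the `G × U_e`-orbit of `(I, γ)` and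
`Frob • b • y = y`. As `U_e` is commutative, such `b` exist for one `y` in the orbit if and only if
they exist for all of them, which is the case if and only if `Frob` stabilizes the `G`-orbit of
`(I, γ)`; they then form a coset of the stabilizer of `y` in `G`, and the orbit is the union of
`[U_e : A]` many `G`-orbits (`natCard_fixed_pairs`, `isEmpty_fixed_pairs`).

The local input consists of two facts about `w`, both stated without residue fields or
ramification theory. Elements fixed by inertia lie in fields generated by roots of unity of order
`q ^ n - 1` (`LocalValuation.mem_adjoin_rootOfUnity_of_fixed`), and adjoining these roots of unity
does not enlarge the value group (`LocalValuation.exists_mem_w_eq_of_fixed`); the latter shows that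
all `e`-th roots of unity occur as `σ β / β` (`LocalValuation.exists_inertia_eq_mul`).
-/

open NumberField IsDedekindDomain

/-! ### The valuation on the algebraic closure of a local field -/

/-- The properties of the extension `w` of the valuation of a nonarchimedean local field `F` to an
algebraic closure `Ω` that determine the tame quotient of the Galois group: `w` is
Galois-invariant and discrete on `F` with uniformizer `ϖ`, the residue field of `Ω` is algebraic
over the field with `q` elements, the elements of that field lift to `F`, and the `q`-power map on
the residue field is induced by an automorphism. Residue fields do not appear explicitly:
`w (x - y) < 1` says that `x` and `y` are congruent modulo the maximal ideal. -/
structure LocalValuation (F Ω : Type*) [Field F] [Field Ω] [Algebra F Ω] where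
  /-- the valuation, written multiplicatively -/
  w : Valuation Ω NNReal
  map_galois : ∀ (σ : Gal(Ω/F)) (x : Ω), w (σ x) = w x
  /-- the number of elements of the residue field of `F` -/
  q : ℕ
  one_lt_q : 1 < q
  w_q_lt_one : w q < 1
  /-- a uniformizer of `F` -/
  ϖ : F
  ϖ_ne_zero : ϖ ≠ 0
  w_ϖ_lt_one : w (algebraMap F Ω ϖ) < 1
  exists_zpow : ∀ a : F, a ≠ 0 → ∃ k : ℤ, w (algebraMap F Ω a) = w (algebraMap F Ω ϖ) ^ k
  exists_pow_sub_lt_one : ∀ x : Ω, w x = 1 → ∃ n : ℕ, n ≠ 0 ∧ w (x ^ (q ^ n) - x) < 1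
  exists_residue : ∀ x : Ω, w x ≤ 1 → w (x ^ q - x) < 1 → ∃ a : F, w (x - algebraMap F Ω a) < 1
  exists_frobenius : ∃ s : Gal(Ω/F), ∀ x : Ω, w x ≤ 1 → w (s x - x ^ q) < 1

namespace Valuation

variable {Ω : Type*} [Field Ω] (w : Valuation Ω NNReal)

theorem eq_one_of_pow_eq_one {ξ : Ω} {m : ℕ} (hm : m ≠ 0) (h : ξ ^ m = 1) : w ξ = 1 := by
  have : w ξ ^ m = 1 := by rw [← map_pow, h, map_one]
  exact (pow_eq_one_iff_of_nonneg zero_le hm).1 this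

theorem sub_lt_one_trans {x y z : Ω} (h : w (x - y) < 1) (h' : w (y - z) < 1) :
    w (x - z) < 1 := by
  rw [← sub_add_sub_cancel x y z]
  exact w.map_add_lt h h'

theorem sub_lt_one_symm {x y : Ω} (h : w (x - y) < 1) : w (y - x) < 1 := by
  rwa [w.map_sub_swap]

theorem le_one_of_sub_lt_one {x y : Ω} (h : w (x - y) < 1) (hy : w y ≤ 1) : w x ≤ 1 := by
  rw [← sub_add_cancel x y]
  exact w.map_add_le h.le hy

theorem mul_sub_mul_lt_one {x y x' y' : Ω} (h : w (x - y) < 1) (h' : w (x' - y') < 1)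
    (hx : w x' ≤ 1) (hy : w y ≤ 1) : w (x * x' - y * y') < 1 := by
  have : x * x' - y * y' = (x - y) * x' + y * (x' - y') := by ring
  rw [this]
  refine w.map_add_lt ?_ ?_
  · rw [map_mul]; exact mul_lt_one_of_lt_of_le h hx
  · rw [map_mul]; exact mul_lt_one_of_nonneg_of_lt_one_right hy zero_le h'

theorem pow_sub_pow_lt_one {x y : Ω} (h : w (x - y) < 1) (hy : w y ≤ 1) (n : ℕ) :
    w (x ^ n - y ^ n) < 1 := by
  have hx := w.le_one_of_sub_lt_one h hy
  induction n with
  | zero => simp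
  | succ n ih =>
    rw [pow_succ, pow_succ]
    exact w.mul_sub_mul_lt_one ih h hx (by rw [map_pow]; exact pow_le_one' hy n)

theorem natCast_le_one (n : ℕ) : w (n : Ω) ≤ 1 := by
  induction n with
  | zero => simp
  | succ n ih => rw [Nat.cast_succ]; exact w.map_add_le ih (by simp)

/-- Roots of unity of order prime to the residue characteristic are determined by their
residues. -/
theorem rootOfUnity_eq_one_of_sub_lt_one {ξ : Ω} {m : ℕ} (hm : w (m : Ω) = 1) (h : ξ ^ m = 1)
    (h1 : w (ξ - 1) < 1) : ξ = 1 := by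
  by_contra hne
  have h0 : ∑ i ∈ Finset.range m, ξ ^ i = 0 := by
    have := mul_geom_sum ξ m
    rw [h, sub_self, mul_eq_zero] at this
    exact this.resolve_left (sub_ne_zero.2 hne)
  have h2 : w (∑ i ∈ Finset.range m, (ξ ^ i - 1)) < 1 :=
    w.map_sum_lt one_ne_zero fun i _ => by
      simpa using w.pow_sub_pow_lt_one h1 (by simp) i
  rw [Finset.sum_sub_distrib, h0] at h2
  simp [hm] at h2

theorem rootOfUnity_eq_of_sub_lt_one {ξ η : Ω} {m : ℕ} (hm : w (m : Ω) = 1) (hξ : ξ ^ m = 1)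
    (hη : η ^ m = 1) (h : w (ξ - η) < 1) : ξ = η := by
  have hm0 : m ≠ 0 := by rintro rfl; simp at hm
  have hη1 := w.eq_one_of_pow_eq_one hm0 hη
  have hη0 : η ≠ 0 := by rintro rfl; simp at hη1
  have : ξ / η = 1 := by
    refine w.rootOfUnity_eq_one_of_sub_lt_one hm (by rw [div_pow, hξ, hη, div_one]) ?_
    rw [← div_self hη0, ← sub_div, map_div₀, hη1, div_one]
    exact h
  rwa [div_eq_one_iff_eq hη0] at this

end Valuation

namespace LocalValuation

variable {F Ω : Type*} [Field F] [Field Ω] [Algebra F Ω] (W : LocalValuation F Ω)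

/-- The inertia group: the automorphisms acting trivially on the residue field. -/
def inertia : Subgroup Gal(Ω/F) where
  carrier := {σ | ∀ x, W.w x ≤ 1 → W.w (σ x - x) < 1}
  one_mem' := by simp
  mul_mem' {σ τ} hσ hτ x hx := W.w.sub_lt_one_trans (y := τ x)
    (hσ (τ x) (by rwa [W.map_galois])) (hτ x hx)
  inv_mem' {σ} hσ x hx := by
    have := hσ (σ⁻¹ x) (by rwa [W.map_galois])
    rw [← AlgEquiv.mul_apply, mul_inv_cancel, AlgEquiv.one_apply] at this
    exact W.w.sub_lt_one_symm this

theorem mem_inertia {σ : Gal(Ω/F)} : σ ∈ W.inertia ↔ ∀ x, W.w x ≤ 1 → W.w (σ x - x) < 1 :=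
  Iff.rfl

theorem conj_mem_inertia (σ : Gal(Ω/F)) {τ : Gal(Ω/F)} (hτ : τ ∈ W.inertia) :
    σ * τ * σ⁻¹ ∈ W.inertia := by
  intro x hx
  have := hτ (σ⁻¹ x) (by rwa [W.map_galois])
  rw [← W.map_galois σ, map_sub] at this
  simpa [AlgEquiv.mul_apply, ← AlgEquiv.mul_apply σ σ⁻¹] using this

theorem map_sub_lt_one (σ : Gal(Ω/F)) {x y : Ω} (h : W.w (x - y) < 1) :
    W.w (σ x - σ y) < 1 := by
  rwa [← map_sub, W.map_galois]

theorem w_q_pow_sub_one {n : ℕ} (hn : n ≠ 0) : W.w ((W.q ^ n - 1 : ℕ) : Ω) = 1 := by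
  have h1 : 1 ≤ W.q ^ n := Nat.one_le_pow _ _ (by have := W.one_lt_q; omega)
  rw [Nat.cast_sub h1, Nat.cast_one, W.w.map_sub_swap]
  refine W.w.map_one_sub_of_lt ?_
  rw [Nat.cast_pow, map_pow]
  exact pow_lt_one₀ zero_le W.w_q_lt_one hn

theorem q_pow_sub_one_ne_zero {n : ℕ} (hn : n ≠ 0) : W.q ^ n - 1 ≠ 0 := by
  have := Nat.one_lt_pow hn W.one_lt_q
  omega

theorem pow_q_pow_eq {n : ℕ} {ξ : Ω} (h : ξ ^ (W.q ^ n - 1) = 1) :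
    ξ ^ (W.q ^ n) = ξ := by
  have h1 : 1 ≤ W.q ^ n := Nat.one_le_pow _ _ (by have := W.one_lt_q; omega)
  rw [← Nat.sub_add_cancel h1, pow_succ, h, one_mul]

/-- The inertia group fixes the roots of unity of order prime to the residue characteristic. -/
theorem inertia_fixes_rootOfUnity {σ : Gal(Ω/F)} (hσ : σ ∈ W.inertia) {ξ : Ω} {m : ℕ}
    (hm : W.w (m : Ω) = 1) (h : ξ ^ m = 1) : σ ξ = ξ := by
  have hm0 : m ≠ 0 := by rintro rfl; simp at hm
  exact W.w.rootOfUnity_eq_of_sub_lt_one hm (by rw [← map_pow, h, map_one]) h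
    (hσ ξ (W.w.eq_one_of_pow_eq_one hm0 h).le)

theorem frobenius_rootOfUnity {s : Gal(Ω/F)} (hs : ∀ x, W.w x ≤ 1 → W.w (s x - x ^ W.q) < 1)
    {ξ : Ω} {m : ℕ} (hm : W.w (m : Ω) = 1) (h : ξ ^ m = 1) : s ξ = ξ ^ W.q := by
  have hm0 : m ≠ 0 := by rintro rfl; simp at hm
  exact W.w.rootOfUnity_eq_of_sub_lt_one hm (by rw [← map_pow, h, map_one])
    (by rw [← pow_mul, mul_comm, pow_mul, h, one_pow])
    (hs ξ (W.w.eq_one_of_pow_eq_one hm0 h).le)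

section

variable [IsAlgClosed Ω]

theorem exists_isPrimitiveRoot {m : ℕ} (hm : W.w (m : Ω) = 1) : ∃ ξ : Ω, IsPrimitiveRoot ξ m := by
  have : NeZero (m : Ω) := ⟨by intro h; simp [h] at hm⟩
  exact HasEnoughRootsOfUnity.exists_primitiveRoot Ω m

/-- Teichmüller representatives: a unit is congruent to a root of unity of order `q ^ n - 1`,
because it satisfies `x ^ (q ^ n) ≡ x` and `X ^ (q ^ n - 1) - 1` splits into linear factors. -/
theorem exists_rootOfUnity_sub_lt_one {x : Ω} (hx : W.w x = 1) :
    ∃ (n : ℕ) (ξ : Ω), n ≠ 0 ∧ ξ ^ (W.q ^ n - 1) = 1 ∧ W.w (x - ξ) < 1 := by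
  obtain ⟨n, hn, h⟩ := W.exists_pow_sub_lt_one x hx
  obtain ⟨ζ, hζ⟩ := W.exists_isPrimitiveRoot (W.w_q_pow_sub_one hn)
  have hpos := Nat.pos_of_ne_zero (W.q_pow_sub_one_ne_zero hn)
  have h1 : W.w (x ^ (W.q ^ n - 1) - 1) < 1 := by
    have h2 : x ^ (W.q ^ n) - x = x * (x ^ (W.q ^ n - 1) - 1) := by
      rw [mul_sub, mul_one, ← pow_succ', Nat.sub_add_cancel (by omega)]
    rwa [h2, map_mul, hx, one_mul] at h
  have h3 := congrArg (Polynomial.eval x) (Polynomial.X_pow_sub_one_eq_prod hpos hζ)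
  simp only [Polynomial.eval_sub, Polynomial.eval_pow, Polynomial.eval_X, Polynomial.eval_one,
    Polynomial.eval_prod, Polynomial.eval_C] at h3
  rw [h3, map_prod] at h1
  by_contra! hcon
  refine h1.not_ge (Finset.one_le_prod' fun ξ hξ => hcon n ξ hn ?_)
  exact (Polynomial.mem_nthRootsFinset hpos 1).1 hξ

theorem exists_pow_q_pow_sub_one_eq_one {ξ : Ω} {m : ℕ} (hm : W.w (m : Ω) = 1) (h : ξ ^ m = 1) :
    ∃ n : ℕ, n ≠ 0 ∧ ξ ^ (W.q ^ n - 1) = 1 := by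
  have hm0 : m ≠ 0 := by rintro rfl; simp at hm
  obtain ⟨n, η, hn, hη, hξη⟩ := W.exists_rootOfUnity_sub_lt_one (W.w.eq_one_of_pow_eq_one hm0 h)
  refine ⟨n, hn, ?_⟩
  have : ξ = η := W.w.rootOfUnity_eq_of_sub_lt_one (m := m * (W.q ^ n - 1))
    (by rw [Nat.cast_mul, map_mul, hm, W.w_q_pow_sub_one hn, one_mul])
    (by rw [pow_mul, h, one_pow]) (by rw [mul_comm, pow_mul, hη, one_pow]) hξη
  rw [this, hη]

theorem mem_inertia_of_fixes_rootsOfUnity {σ : Gal(Ω/F)}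
    (h : ∀ (n : ℕ) (ξ : Ω), n ≠ 0 → ξ ^ (W.q ^ n - 1) = 1 → σ ξ = ξ) : σ ∈ W.inertia := by
  intro x hx
  rcases hx.lt_or_eq with hx | hx
  · exact W.w.map_sub_lt (by rwa [W.map_galois]) hx
  · obtain ⟨n, ξ, hn, hξ, hxξ⟩ := W.exists_rootOfUnity_sub_lt_one hx
    have h1 := W.map_sub_lt_one σ hxξ
    rw [h n ξ hn hξ] at h1
    exact W.w.sub_lt_one_trans h1 (W.w.sub_lt_one_symm hxξ)

/-- The maximal unramified extension of an intermediate field `L` is generated by roots of unity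
of order prime to the residue characteristic. -/
theorem mem_adjoin_rootOfUnity_of_fixed [IsGalois F Ω] (L : IntermediateField F Ω) {y : Ω}
    (hy : ∀ σ ∈ W.inertia, σ ∈ L.fixingSubgroup → σ y = y) :
    ∃ (n : ℕ) (ξ : Ω), n ≠ 0 ∧ ξ ^ (W.q ^ n - 1) = 1 ∧ y ∈ IntermediateField.adjoin L {ξ} := by
  set S : Set Ω := {ξ | ∃ n : ℕ, n ≠ 0 ∧ ξ ^ (W.q ^ n - 1) = 1} with hS
  have hyS : y ∈ IntermediateField.adjoin L S := by
    rw [← InfiniteGalois.fixedField_fixingSubgroup (IntermediateField.adjoin L S)]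
    rintro ⟨τ, hτ⟩
    change τ y = y
    refine hy (τ.restrictScalars F) (W.mem_inertia_of_fixes_rootsOfUnity fun n ξ hn hξ => ?_) ?_
    · exact hτ ⟨ξ, IntermediateField.subset_adjoin L S ⟨n, hn, hξ⟩⟩
    · exact fun z => τ.commutes z
  obtain ⟨T, hTS, hyT⟩ := IntermediateField.exists_finset_of_mem_adjoin hyS
  have hT : ∀ ξ ∈ T, ∃ n : ℕ, n ≠ 0 ∧ ξ ^ (W.q ^ n - 1) = 1 := fun ξ h => hTS h
  choose! n hn hξ using hT
  have hN : ∏ ξ ∈ T, n ξ ≠ 0 := Finset.prod_ne_zero_iff.2 fun ξ hξT => hn ξ hξT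
  obtain ⟨ζ, hζ⟩ := W.exists_isPrimitiveRoot (W.w_q_pow_sub_one hN)
  have : NeZero (W.q ^ (∏ ξ ∈ T, n ξ) - 1) := ⟨W.q_pow_sub_one_ne_zero hN⟩
  refine ⟨_, ζ, hN, hζ.pow_eq_one, ?_⟩
  refine IntermediateField.adjoin_le_iff.2 (fun ξ hξT => ?_) hyT
  obtain ⟨d, hd⟩ := Nat.pow_sub_one_dvd_pow_sub_one W.q (Finset.dvd_prod_of_mem n hξT)
  obtain ⟨i, -, rfl⟩ := hζ.eq_pow_of_pow_eq_one (ξ := ξ) (by rw [hd, pow_mul, hξ ξ hξT, one_pow])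
  exact pow_mem (IntermediateField.mem_adjoin_simple_self L ζ) i

end

end LocalValuation

/-! ### Unramified extensions and the Frobenius automorphism -/

namespace Valuation

variable {Ω : Type*} [Field Ω] (w : Valuation Ω NNReal)

theorem eval_lt_one {P : Polynomial Ω} (hP : ∀ i, w (P.coeff i) < 1) {x : Ω} (hx : w x ≤ 1) :
    w (P.eval x) < 1 := by
  rw [Polynomial.eval_eq_sum_range]
  refine w.map_sum_lt one_ne_zero fun i _ => ?_
  rw [map_mul, map_pow]
  exact mul_lt_one_of_lt_of_le (hP i) (pow_le_one' hx i)

/-- A polynomial over the residue field with more roots than its degree vanishes. -/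
theorem coeff_lt_one_of_eval_lt_one {P : Polynomial Ω} (hP : ∀ i, w (P.coeff i) ≤ 1)
    {ι : Type*} [Fintype ι] {f : ι → Ω} (hf : ∀ i, w (f i) ≤ 1)
    (hinj : ∀ i j, w (f i - f j) < 1 → i = j) (hev : ∀ i, w (P.eval (f i)) < 1)
    (hdeg : P.natDegree < Fintype.card ι) (n : ℕ) : w (P.coeff n) < 1 := by
  have hsub : (P.coeffs : Set Ω) ⊆ w.valuationSubring.toSubring := by
    intro c hc
    obtain ⟨i, -, rfl⟩ := Polynomial.mem_coeffs_iff.1 hc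
    exact hP i
  set Q : Polynomial w.valuationSubring := P.toSubring w.valuationSubring.toSubring hsub with hQ
  have hQP : Q.map w.valuationSubring.subtype = P :=
    Polynomial.map_toSubring P w.valuationSubring.toSubring hsub
  have hres : ∀ a : w.valuationSubring, IsLocalRing.residue _ a = 0 ↔ w (a : Ω) < 1 := fun a => by
    rw [IsLocalRing.residue_eq_zero_iff, Valuation.mem_maximalIdeal_iff]
  have h0 : Q.map (IsLocalRing.residue w.valuationSubring) = 0 := by
    refine Polynomial.eq_zero_of_natDegree_lt_card_of_eval_eq_zero _
      (f := fun i => IsLocalRing.residue w.valuationSubring ⟨f i, hf i⟩) ?_ ?_ ?_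
    · intro i j hij
      refine hinj i j ?_
      have := sub_eq_zero.2 hij
      rw [← RingHom.map_sub, hres] at this
      exact this
    · intro i
      rw [Polynomial.eval_map_apply, hres]
      have := Polynomial.eval_map_apply w.valuationSubring.subtype (p := Q) ⟨f i, hf i⟩
      rw [hQP] at this
      exact lt_of_eq_of_lt (congrArg w this.symm) (hev i)
    · refine lt_of_le_of_lt Polynomial.natDegree_map_le ?_
      rw [hQ, Polynomial.natDegree_toSubring]
      exact hdeg
  have h1 := congrArg (fun R => Polynomial.coeff R n) h0
  simp only [Polynomial.coeff_map, Polynomial.coeff_zero, hres] at h1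
  rw [← hQP, Polynomial.coeff_map]
  exact h1

end Valuation

namespace LocalValuation

variable {F Ω : Type*} [Field F] [Field Ω] [Algebra F Ω] (W : LocalValuation F Ω)

/-- The Galois group acts on the roots of unity of order `q ^ n - 1` through powers of the
Frobenius: the polynomial with the roots `ξ ^ (q ^ i)` is fixed by a Frobenius automorphism, so
it is congruent to a polynomial over `F`. -/
theorem exists_galois_eq_pow {ξ : Ω} {n : ℕ} (hn : n ≠ 0) (hξ : ξ ^ (W.q ^ n - 1) = 1)
    (σ : Gal(Ω/F)) : ∃ d < n, σ ξ = ξ ^ (W.q ^ d) := by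
  obtain ⟨s, hs⟩ := W.exists_frobenius
  have hm := W.w_q_pow_sub_one hn
  have hm0 := W.q_pow_sub_one_ne_zero hn
  have hsξ : s ξ = ξ ^ W.q := W.frobenius_rootOfUnity hs hm hξ
  have hw1 : W.w ξ = 1 := W.w.eq_one_of_pow_eq_one hm0 hξ
  have hpow : ∀ i, W.w (ξ ^ (W.q ^ i)) ≤ 1 := fun i => by rw [map_pow, hw1, one_pow]
  set P : Polynomial W.w.valuationSubring :=
    ∏ i ∈ Finset.range n, (Polynomial.X - Polynomial.C ⟨ξ ^ (W.q ^ i), hpow i⟩) with hP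
  set Q : Polynomial Ω := P.map W.w.valuationSubring.subtype with hQ
  have hQprod : Q = ∏ i ∈ Finset.range n, (Polynomial.X - Polynomial.C (ξ ^ (W.q ^ i))) := by
    rw [hQ, hP, Polynomial.map_prod]
    refine Finset.prod_congr rfl fun i _ => ?_
    rw [Polynomial.map_sub, Polynomial.map_X, Polynomial.map_C]
    rfl
  have hQs : Q.map (s : Ω →+* Ω) = Q := by
    have h1 : Q.map (s : Ω →+* Ω) =
        ∏ i ∈ Finset.range n, (Polynomial.X - Polynomial.C (ξ ^ (W.q ^ (i + 1)))) := by
      rw [hQprod, Polynomial.map_prod]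
      refine Finset.prod_congr rfl fun i _ => ?_
      rw [Polynomial.map_sub, Polynomial.map_X, Polynomial.map_C]
      congr 2
      change s (ξ ^ (W.q ^ i)) = _
      rw [map_pow, hsξ, ← pow_mul, pow_succ']
    rw [h1]
    refine mul_right_cancel₀ (Polynomial.X_sub_C_ne_zero ξ) ?_
    have h2 := Finset.prod_range_succ'
      (fun i => Polynomial.X - Polynomial.C (ξ ^ (W.q ^ i))) n
    have h3 := Finset.prod_range_succ
      (fun i => Polynomial.X - Polynomial.C (ξ ^ (W.q ^ i))) n
    rw [h3, ← hQprod] at h2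
    simpa [W.pow_q_pow_eq hξ] using h2.symm
  -- a coefficient fixed by `s` has residue in the field with `q` elements, so it lifts to `F`
  have hcoeff : ∀ i, W.w (σ (Q.coeff i) - Q.coeff i) < 1 := by
    intro i
    have hc1 : W.w (Q.coeff i) ≤ 1 := by
      rw [hQ, Polynomial.coeff_map]
      exact (P.coeff i).2
    have hsc : s (Q.coeff i) = Q.coeff i := by
      have := congrArg (fun R => Polynomial.coeff R i) hQs
      rw [Polynomial.coeff_map] at this
      exact this
    have hcq := hs _ hc1
    rw [hsc] at hcq
    obtain ⟨a, ha⟩ := W.exists_residue _ hc1 (W.w.sub_lt_one_symm hcq)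
    have h2 := W.map_sub_lt_one σ ha
    rw [σ.commutes] at h2
    exact W.w.sub_lt_one_trans h2 (W.w.sub_lt_one_symm ha)
  have hQξ : Q.eval ξ = 0 := by
    rw [hQprod, Polynomial.eval_prod]
    exact Finset.prod_eq_zero (Finset.mem_range.2 (Nat.pos_of_ne_zero hn)) (by simp)
  have hσQ : (Q.map (σ : Ω →+* Ω)).eval (σ ξ) = 0 := by
    have := Polynomial.eval_map_apply (σ : Ω →+* Ω) (p := Q) ξ
    rw [hQξ, map_zero] at this
    exact this
  have hev : W.w (Q.eval (σ ξ)) < 1 := by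
    have := W.w.eval_lt_one (P := Q.map (σ : Ω →+* Ω) - Q) (fun i => by
      rw [Polynomial.coeff_sub, Polynomial.coeff_map]; exact hcoeff i) (x := σ ξ)
      (by rw [W.map_galois, hw1])
    rwa [Polynomial.eval_sub, hσQ, zero_sub, Valuation.map_neg] at this
  rw [hQprod, Polynomial.eval_prod, map_prod] at hev
  obtain ⟨d, hd, hlt⟩ : ∃ d ∈ Finset.range n, W.w (σ ξ - ξ ^ (W.q ^ d)) < 1 := by
    by_contra! hcon
    refine hev.not_ge (Finset.one_le_prod' fun i hi => ?_)
    simpa using hcon i hi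
  refine ⟨d, Finset.mem_range.1 hd, W.w.rootOfUnity_eq_of_sub_lt_one hm ?_ ?_ hlt⟩
  · rw [← map_pow, hξ, map_one]
  · rw [← pow_mul, mul_comm, pow_mul, hξ, one_pow]

section

variable [IsAlgClosed Ω] [IsGalois F Ω]

/-- Adjoining a root of unity of order prime to the residue characteristic does not enlarge the
value group: the powers of the root of unity that form a basis remain linearly independent over
the residue field, because the conjugates of the root of unity remain distinct there. -/
theorem exists_mem_w_eq_of_mem_adjoin (L : IntermediateField F Ω) {ξ y : Ω} {m : ℕ}
    (hm : W.w (m : Ω) = 1) (hξ : ξ ^ m = 1) (hy : y ∈ IntermediateField.adjoin L {ξ}) :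
    ∃ z ∈ L, W.w z = W.w y := by
  have hm0 : m ≠ 0 := by rintro rfl; simp at hm
  by_cases hy0 : y = 0
  · exact ⟨0, zero_mem L, by rw [hy0]⟩
  have hint : IsIntegral L ξ := Algebra.IsIntegral.isIntegral ξ
  obtain ⟨P, hPdeg, hPy⟩ :=
    (IntermediateField.adjoin.powerBasis hint).exists_eq_aeval ⟨y, hy⟩
  rw [IntermediateField.adjoin.powerBasis_gen] at hPy
  rw [IntermediateField.adjoin.powerBasis_dim] at hPdeg
  replace hPy : Polynomial.aeval ξ P = y := by
    have h1 := congrArg (algebraMap (IntermediateField.adjoin L {ξ}) Ω) hPy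
    rw [← Polynomial.aeval_algebraMap_apply] at h1
    exact h1.symm
  have hP0 : P ≠ 0 := by rintro rfl; exact hy0 (by rw [← hPy, map_zero])
  -- the coefficient of largest absolute value
  obtain ⟨i₀, hi₀, hmax⟩ := P.support.exists_max_image
    (fun i => W.w (algebraMap L Ω (P.coeff i))) (Polynomial.support_nonempty.2 hP0)
  set a : L := P.coeff i₀ with ha
  have ha0 : a ≠ 0 := Polynomial.mem_support_iff.1 hi₀
  have hwa : 0 < W.w (algebraMap L Ω a) := by
    rw [pos_iff_ne_zero, Valuation.ne_zero_iff]
    exact fun h => ha0 ((algebraMap L Ω).injective (by rw [h, map_zero]))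
  have hle : ∀ i, W.w (algebraMap L Ω (P.coeff i)) ≤ W.w (algebraMap L Ω a) := by
    intro i
    by_cases hi : i ∈ P.support
    · exact hmax i hi
    · rw [Polynomial.notMem_support_iff.1 hi, map_zero, map_zero]
      exact zero_le
  -- after scaling, the largest coefficient is `1`, and `Q.eval ξ` has to be shown to be a unit
  refine ⟨algebraMap L Ω a, a.2, ?_⟩
  set Q : Polynomial Ω := (Polynomial.C a⁻¹ * P).map (algebraMap L Ω) with hQ
  have hQc : ∀ i, W.w (Q.coeff i) = W.w (algebraMap L Ω (P.coeff i)) / W.w (algebraMap L Ω a) := by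
    intro i
    rw [hQ, Polynomial.coeff_map, Polynomial.coeff_C_mul, map_mul, map_mul, map_inv₀, map_inv₀,
      inv_mul_eq_div]
  have hQev : ∀ η : Ω, Q.eval η = (algebraMap L Ω a)⁻¹ * Polynomial.aeval η P := by
    intro η
    rw [hQ, Polynomial.eval_map_algebraMap, map_mul, Polynomial.aeval_C, map_inv₀]
  have hdiv : W.w (Q.eval ξ) = W.w y / W.w (algebraMap L Ω a) := by
    rw [hQev, hPy, map_mul, map_inv₀, inv_mul_eq_div]
  have hQ1 : ∀ i, W.w (Q.coeff i) ≤ 1 := fun i => by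
    rw [hQc]; exact div_le_one_of_le₀ (hle i) zero_le
  have hξ1 : ∀ η : Ω, η ^ m = 1 → W.w η ≤ 1 := fun η h => (W.w.eq_one_of_pow_eq_one hm0 h).le
  have hone : W.w (Q.eval ξ) ≤ 1 := by
    rw [Polynomial.eval_eq_sum_range]
    refine W.w.map_sum_le fun i _ => ?_
    rw [map_mul, map_pow]
    exact mul_le_one' (hQ1 i) (pow_le_one' (hξ1 ξ hξ) i)
  rcases hone.lt_or_eq with hlt | heq
  · -- otherwise the residue of `Q` vanishes at the residues of all conjugates of `ξ`, which are
    -- distinct and more than its degree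
    exfalso
    have hroot : ∀ η : (minpoly L ξ).rootSet Ω, ∃ τ : Gal(Ω/L), τ ξ = η := fun η =>
      minpoly.exists_algEquiv_of_root' hint.isAlgebraic ((Polynomial.mem_rootSet.1 η.2).2)
    have hη : ∀ η : (minpoly L ξ).rootSet Ω, (η : Ω) ^ m = 1 := fun η => by
      obtain ⟨τ, hτ⟩ := hroot η
      rw [← hτ, ← map_pow, hξ, map_one]
    have := W.w.coeff_lt_one_of_eval_lt_one hQ1 (ι := (minpoly L ξ).rootSet Ω)
      (f := fun η => (η : Ω)) (fun η => hξ1 _ (hη η))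
      (fun η η' h => Subtype.ext (W.w.rootOfUnity_eq_of_sub_lt_one hm (hη η) (hη η') h)) ?_ ?_ i₀
    · rw [hQc, ← ha, div_self hwa.ne'] at this
      exact lt_irrefl _ this
    · intro η
      obtain ⟨τ, hτ⟩ := hroot η
      have h1 : Q.eval (η : Ω) = τ (Q.eval ξ) := by
        rw [hQev, hQev, map_mul, map_inv₀, τ.commutes, ← hτ, Polynomial.aeval_algHom_apply]
      rw [h1]
      exact lt_of_eq_of_lt (W.map_galois (τ.restrictScalars F) (Q.eval ξ)) hlt
    · rw [Polynomial.card_rootSet_eq_natDegree (Algebra.IsSeparable.isSeparable L ξ)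
        (IsAlgClosed.splits _)]
      refine lt_of_le_of_lt Polynomial.natDegree_map_le (lt_of_le_of_lt ?_ hPdeg)
      exact Polynomial.natDegree_C_mul_le _ _
  · rw [heq] at hdiv
    exact (((div_eq_one_iff_eq hwa.ne').1 hdiv.symm)).symm

/-- Unramified extensions of `L` have the same value group as `L`. -/
theorem exists_mem_w_eq_of_fixed (L : IntermediateField F Ω) {y : Ω}
    (hy : ∀ σ ∈ W.inertia, σ ∈ L.fixingSubgroup → σ y = y) : ∃ z ∈ L, W.w z = W.w y := by
  obtain ⟨n, ξ, hn, hξ, hyξ⟩ := W.mem_adjoin_rootOfUnity_of_fixed L hy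
  exact W.exists_mem_w_eq_of_mem_adjoin L (W.w_q_pow_sub_one hn) hξ hyξ

/-- The maximal unramified extension of `F` has the same value group as `F`. -/
theorem exists_zpow_of_fixed {y : Ω} (hy0 : y ≠ 0) (hy : ∀ σ ∈ W.inertia, σ y = y) :
    ∃ k : ℤ, W.w y = W.w (algebraMap F Ω W.ϖ) ^ k := by
  obtain ⟨z, hz, hzy⟩ := W.exists_mem_w_eq_of_fixed ⊥ fun σ hσ _ => hy σ hσ
  obtain ⟨a, rfl⟩ := IntermediateField.mem_bot.1 hz
  rw [← hzy]
  refine W.exists_zpow a ?_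
  rintro rfl
  rw [map_zero, map_zero, eq_comm, Valuation.zero_iff] at hzy
  exact hy0 hzy

/-- Inertia and a Frobenius automorphism generate a dense subgroup of the Galois group. -/
theorem eq_top_of_isClosed {s : Gal(Ω/F)} (hs : ∀ x, W.w x ≤ 1 → W.w (s x - x ^ W.q) < 1)
    {H : Subgroup Gal(Ω/F)} (hH : IsClosed (H : Set Gal(Ω/F))) (hI : W.inertia ≤ H)
    (hsH : s ∈ H) : H = ⊤ := by
  have hfix := InfiniteGalois.fixingSubgroup_fixedField (⟨H, hH⟩ : ClosedSubgroup Gal(Ω/F))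
  change (IntermediateField.fixedField H).fixingSubgroup = H at hfix
  rw [← hfix]
  have hbot : IntermediateField.fixedField H = ⊥ := by
    refine eq_bot_iff.2 fun y hy => ?_
    rw [IntermediateField.mem_fixedField_iff] at hy
    obtain ⟨n, ξ, hn, hξ, hyξ⟩ := W.mem_adjoin_rootOfUnity_of_fixed ⊥ (y := y)
      fun σ hσ _ => hy σ (hI hσ)
    refine (InfiniteGalois.mem_bot_iff_fixed y).2 fun σ => ?_
    obtain ⟨d, -, hd⟩ := W.exists_galois_eq_pow hn hξ σ
    have hsd : ∀ d, (s ^ d) ξ = ξ ^ (W.q ^ d) := by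
      intro d
      induction d with
      | zero => simp
      | succ d ih =>
        rw [pow_succ', AlgEquiv.mul_apply, ih, map_pow,
          W.frobenius_rootOfUnity hs (W.w_q_pow_sub_one hn) hξ, ← pow_mul, pow_succ']
    have hagree : ∀ x ∈ IntermediateField.adjoin (⊥ : IntermediateField F Ω) {ξ},
        σ x = (s ^ d) x := by
      intro x hx
      induction hx using IntermediateField.adjoin_induction with
      | mem x hx => rw [Set.mem_singleton_iff.1 hx, hsd, hd]
      | algebraMap x =>
        obtain ⟨a, ha⟩ := IntermediateField.mem_bot.1 x.2
        rw [IntermediateField.algebraMap_apply, ← ha, AlgEquiv.commutes, AlgEquiv.commutes]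
      | add x y _ _ hx hy => rw [map_add, map_add, hx, hy]
      | inv x _ hx => rw [map_inv₀, map_inv₀, hx]
      | mul x y _ _ hx hy => rw [map_mul, map_mul, hx, hy]
    rw [hagree y hyξ, hy (s ^ d) (pow_mem hsH d)]
  rw [hbot, IntermediateField.fixingSubgroup_bot]

end

end LocalValuation

/-! ### The tame quotient of the Galois group -/

theorem Nat.pow_pow_modEq_cancel {q n : ℕ} (hq : 1 < q) (hn : n ≠ 0) {d d' : ℕ}
    (h : q ^ d ≡ q ^ d' [MOD q ^ n - 1]) : d ≡ d' [MOD n] := by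
  wlog hle : d ≤ d' generalizing d d'
  · exact (this h.symm (le_of_not_ge hle)).symm
  obtain ⟨r, rfl⟩ := Nat.exists_eq_add_of_le hle
  have hqn : 1 ≤ q ^ n := Nat.one_le_pow _ _ (by omega)
  have h1 : q ^ n ≡ 1 [MOD q ^ n - 1] := ((Nat.modEq_iff_dvd' hqn).2 dvd_rfl).symm
  have hcop : (q ^ n - 1).gcd (q ^ d) = 1 := by
    refine Nat.Coprime.pow_right d (Nat.Coprime.coprime_dvd_right (dvd_pow_self q hn) ?_)
    exact (Nat.coprime_self_sub_left hqn).2 (Nat.coprime_one_left _)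
  have h2 : q ^ r ≡ 1 [MOD q ^ n - 1] := by
    refine Nat.ModEq.cancel_left_of_coprime hcop ?_
    rw [mul_one, ← pow_add]
    exact h.symm
  have h3 : q ^ (r % n) ≡ 1 [MOD q ^ n - 1] := by
    refine Nat.ModEq.trans ?_ h2
    conv_rhs => rw [← Nat.div_add_mod r n, pow_add, pow_mul]
    simpa using ((h1.pow (r / n)).mul_right (q ^ (r % n))).symm
  have h4 : r % n = 0 := by
    by_contra hr
    have hlt : r % n < n := Nat.mod_lt _ (Nat.pos_of_ne_zero hn)
    have h5 := (Nat.modEq_iff_dvd' (Nat.one_le_pow (r % n) q (by omega))).1 h3.symm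
    have h6 := Nat.pow_lt_pow_right hq hlt
    have h7 := Nat.one_lt_pow hr hq
    have h8 := Nat.le_of_dvd (by omega) h5
    omega
  exact (Nat.modEq_iff_dvd' (by omega)).2 (by simpa using Nat.dvd_of_mod_eq_zero h4)

namespace LocalValuation

variable {F Ω : Type*} [Field F] [Field Ω] [Algebra F Ω] (W : LocalValuation F Ω)

section TameCharacter

variable {e : ℕ} {β : Ω} (hβ : β ^ e = algebraMap F Ω W.ϖ)

theorem algebraMap_ϖ_ne_zero : algebraMap F Ω W.ϖ ≠ 0 := by
  rw [map_ne_zero]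
  exact W.ϖ_ne_zero

theorem w_ϖ_pos : 0 < W.w (algebraMap F Ω W.ϖ) := by
  rw [pos_iff_ne_zero, Valuation.ne_zero_iff]
  exact W.algebraMap_ϖ_ne_zero

include hβ

theorem ne_zero_of_pow_eq_ϖ (he : e ≠ 0) : β ≠ 0 := by
  rintro rfl
  rw [zero_pow he] at hβ
  exact W.algebraMap_ϖ_ne_zero hβ.symm

theorem w_lt_one_of_pow_eq_ϖ : W.w β < 1 := by
  by_contra! h
  have := one_le_pow₀ h (n := e)
  rw [← map_pow, hβ] at this
  exact this.not_gt W.w_ϖ_lt_one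

theorem div_pow_eq_one (σ : Gal(Ω/F)) : (σ β / β) ^ e = 1 := by
  rw [div_pow, ← map_pow, hβ, AlgEquiv.commutes, div_self W.algebraMap_ϖ_ne_zero]

/-- Every root of unity of order dividing `e` occurs as `τ β / β` for some `τ` in the inertia
group: otherwise a proper power of `β` would be fixed by the inertia group, although its valuation
does not lie in the value group of `F`. -/
theorem exists_inertia_eq_mul [IsAlgClosed Ω] [IsGalois F Ω] (he : W.w (e : Ω) = 1) {ζ : Ω}
    (hζ : ζ ^ e = 1) : ∃ τ ∈ W.inertia, τ β = ζ * β := by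
  have he0 : e ≠ 0 := by rintro rfl; simp at he
  have : NeZero e := ⟨he0⟩
  have hβ0 := W.ne_zero_of_pow_eq_ϖ hβ he0
  -- `T` consists of the roots of unity that do occur
  set T : Subgroup Ωˣ :=
    { carrier := {u | u ^ e = 1 ∧ ∃ τ ∈ W.inertia, τ β = u * β}
      one_mem' := ⟨one_pow e, 1, one_mem _, by simp⟩
      mul_mem' := by
        rintro u u' ⟨hu, τ, hτ, hτu⟩ ⟨hu', τ', hτ', hτu'⟩
        refine ⟨by rw [mul_pow, hu, hu', one_mul], τ * τ', mul_mem hτ hτ', ?_⟩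
        have h1 : τ (u' : Ω) = u' := W.inertia_fixes_rootOfUnity hτ he
          (by rw [← Units.val_pow_eq_pow_val, hu', Units.val_one])
        rw [AlgEquiv.mul_apply, hτu', map_mul, h1, hτu, Units.val_mul]
        ring
      inv_mem' := by
        rintro u ⟨hu, τ, hτ, hτu⟩
        refine ⟨by rw [inv_pow, hu, inv_one], τ⁻¹, inv_mem hτ, ?_⟩
        have h1 : τ⁻¹ (u : Ω) = u := W.inertia_fixes_rootOfUnity (inv_mem hτ) he
          (by rw [← Units.val_pow_eq_pow_val, hu, Units.val_one])
        have h2 := congrArg (τ⁻¹ : Gal(Ω/F)) hτu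
        rw [← AlgEquiv.mul_apply, inv_mul_cancel, AlgEquiv.one_apply, map_mul, h1] at h2
        rw [Units.val_inv_eq_inv_val, inv_mul_eq_div, eq_div_iff u.ne_zero, mul_comm, ← h2] } with hT
  have hTle : T ≤ rootsOfUnity e Ω := fun u hu => (mem_rootsOfUnity e u).2 hu.1
  have : Finite T := Finite.of_injective _ (Subgroup.inclusion_injective hTle)
  have hfix : ∀ σ ∈ W.inertia, σ (β ^ Nat.card T) = β ^ Nat.card T := by
    intro σ hσ
    have hc := W.div_pow_eq_one hβ σ
    have hc0 : σ β / β ≠ 0 := div_ne_zero (by rwa [map_ne_zero]) hβ0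
    have hmem : Units.mk0 (σ β / β) hc0 ∈ T := by
      refine ⟨Units.ext (by simpa using hc), σ, hσ, ?_⟩
      rw [Units.val_mk0, div_mul_cancel₀ _ hβ0]
    have h1 := congrArg (fun u : T => ((u : Ωˣ) : Ω)) (pow_card_eq_one' (x := (⟨_, hmem⟩ : T)))
    simp only [Subgroup.coe_pow, Units.val_pow_eq_pow_val, Units.val_mk0, Subgroup.coe_one,
      Units.val_one, div_pow] at h1
    rw [map_pow]
    exact (div_eq_one_iff_eq (pow_ne_zero _ hβ0)).1 h1
  -- `w (β ^ #T)` lies in the value group of `F`, which is generated by `w (β ^ e)`, so `e ∣ #T`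
  obtain ⟨k, hk⟩ := W.exists_zpow_of_fixed (pow_ne_zero _ hβ0) hfix
  rw [← hβ, map_pow, map_pow, ← zpow_natCast, ← zpow_natCast, ← zpow_mul] at hk
  have hwβ : 0 < W.w β := by rwa [pos_iff_ne_zero, Valuation.ne_zero_iff]
  have hk' : (Nat.card T : ℤ) = e * k :=
    zpow_right_injective₀ hwβ (W.w_lt_one_of_pow_eq_ϖ hβ).ne hk
  have hdvd : e ∣ Nat.card T := Int.natCast_dvd_natCast.1 ⟨k, hk'⟩
  obtain ⟨ζ₀, hζ₀⟩ := W.exists_isPrimitiveRoot he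
  have hTeq : T = rootsOfUnity e Ω := by
    refine Subgroup.eq_of_le_of_card_ge hTle ?_
    rw [hζ₀.card_rootsOfUnity]
    exact Nat.le_of_dvd Nat.card_pos hdvd
  have hζ0 : ζ ≠ 0 := by rintro rfl; rw [zero_pow he0] at hζ; exact zero_ne_one hζ
  have hζT : Units.mk0 ζ hζ0 ∈ T := by
    rw [hTeq, mem_rootsOfUnity]
    exact Units.ext (by simpa using hζ)
  exact hζT.2

/-- If `π` has the valuation of `β`, then `σ π / π` and `σ β / β` are congruent for `σ` in the
inertia group. -/
theorem div_sub_div_lt_one {π : Ω} (he : e ≠ 0)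
    (hπ : W.w π ^ e = W.w (algebraMap F Ω W.ϖ)) {σ : Gal(Ω/F)} (hσ : σ ∈ W.inertia) :
    W.w (σ π / π - σ β / β) < 1 := by
  have hβ0 := W.ne_zero_of_pow_eq_ϖ hβ he
  have hw : W.w π = W.w β := by
    rw [← hβ, map_pow] at hπ
    exact (pow_left_inj₀ zero_le zero_le he).1 hπ
  have hwβ : W.w β ≠ 0 := by rwa [Valuation.ne_zero_iff]
  have hπ0 : π ≠ 0 := by rwa [← Valuation.ne_zero_iff W.w, hw]
  have hu : W.w (π / β) = 1 := by rw [map_div₀, hw, div_self hwβ]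
  have h1 := hσ (π / β) hu.le
  have hσβ : W.w (σ β / β) = 1 := by rw [map_div₀, W.map_galois, div_self hwβ]
  have h2 : σ π / π - σ β / β = (σ β / β) * ((σ (π / β) - π / β) / (π / β)) := by
    have : σ β ≠ 0 := by rwa [map_ne_zero]
    rw [map_div₀]
    field_simp
  rw [h2, map_mul, hσβ, one_mul, map_div₀, hu, div_one]
  exact h1

end TameCharacter

section Hom

variable {G : Type*} [Group G] (f : Gal(Ω/F) →* G)

theorem eq_of_map_eq {x : Ω} (hx : x ∈ IntermediateField.fixedField f.ker) {σ σ' : Gal(Ω/F)}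
    (h : f σ = f σ') : σ x = σ' x := by
  rw [IntermediateField.mem_fixedField_iff] at hx
  have h1 := hx (σ'⁻¹ * σ) (by rw [MonoidHom.mem_ker, map_mul, map_inv, h, inv_mul_cancel])
  have h2 := congrArg σ' h1
  rwa [← AlgEquiv.mul_apply, mul_inv_cancel_left] at h2

/-- For `π` in the field cut out by `f`, the product of the conjugates of `π` under the inertia
group lies in the maximal unramified extension of `F`. -/
theorem exists_zpow_of_mem_fixedField [IsAlgClosed Ω] [IsGalois F Ω] [Finite G] {π : Ω}
    (hπ : π ∈ IntermediateField.fixedField f.ker) (hπ0 : π ≠ 0) :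
    ∃ j : ℤ, W.w π ^ Nat.card (W.inertia.map f) = W.w (algebraMap F Ω W.ϖ) ^ j := by
  have := Fintype.ofFinite (W.inertia.map f)
  have hsec : ∀ g : W.inertia.map f, ∃ σ ∈ W.inertia, f σ = g := fun g => g.2
  choose r hr hfr using hsec
  have hw : W.w (∏ g, r g π) = W.w π ^ Nat.card (W.inertia.map f) := by
    rw [map_prod, Finset.prod_congr rfl fun g _ => W.map_galois (r g) π, Finset.prod_const,
      Finset.card_univ, Nat.card_eq_fintype_card]
  rw [← hw]
  refine W.exists_zpow_of_fixed ?_ fun τ hτ => ?_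
  · exact Finset.prod_ne_zero_iff.2 fun g _ => by rwa [map_ne_zero]
  · rw [map_prod, ← Equiv.prod_comp (Equiv.mulLeft (⟨f τ, τ, hτ, rfl⟩ : W.inertia.map f))
      (fun g => r g π)]
    refine Finset.prod_congr rfl fun g _ => ?_
    rw [← AlgEquiv.mul_apply]
    refine eq_of_map_eq f hπ ?_
    rw [hfr, map_mul, hfr]
    rfl

/-- If `w π` generates the value group of the field cut out by `f` and `e` divides the
ramification index, then `e` is the ramification index. -/
theorem w_pow_eq_of_dvd [IsAlgClosed Ω] [IsGalois F Ω] [Finite G] {e k : ℕ} {π : Ω}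
    (hcard : Nat.card (W.inertia.map f) = e) (hπ : π ∈ IntermediateField.fixedField f.ker)
    (hπ1 : W.w π < 1) (hk : W.w (algebraMap F Ω W.ϖ) = W.w π ^ k) (hek : e ∣ k) :
    W.w π ^ e = W.w (algebraMap F Ω W.ϖ) := by
  have he0 : e ≠ 0 := by rw [← hcard]; exact Nat.card_pos.ne'
  have hk0 : k ≠ 0 := by
    rintro rfl
    have := W.w_ϖ_lt_one
    rw [hk, pow_zero] at this
    exact lt_irrefl _ this
  have hπpos : 0 < W.w π := by
    rw [pos_iff_ne_zero]
    intro h0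
    have := W.w_ϖ_pos
    rw [hk, h0, zero_pow hk0] at this
    exact lt_irrefl _ this
  obtain ⟨j, hj⟩ := W.exists_zpow_of_mem_fixedField f hπ ((Valuation.ne_zero_iff W.w).1 hπpos.ne')
  obtain ⟨l, rfl⟩ := hek
  rw [hcard, hk, ← zpow_natCast, ← zpow_natCast, ← zpow_mul] at hj
  have h1 : (e : ℤ) = (e * l : ℕ) * j := zpow_right_injective₀ hπpos hπ1.ne hj
  have h2 : (l : ℤ) * j = 1 := by
    have he' : (e : ℤ) ≠ 0 := by exact_mod_cast he0
    refine mul_left_cancel₀ he' ?_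
    rw [mul_one, ← mul_assoc]
    exact_mod_cast h1.symm
  have h3 : l = 1 := by
    have := Int.isUnit_iff.1 (IsUnit.of_mul_eq_one j h2)
    omega
  rw [hk, h3, mul_one]

/-- The order `e` of a tame character congruent to `σ π / π` divides the ramification index. -/
theorem dvd_of_isPrimitiveRoot {e k : ℕ} (he : W.w (e : Ω) = 1) {π c : Ω} {σ : Gal(Ω/F)}
    (hσ : σ ∈ W.inertia) (hk : W.w (algebraMap F Ω W.ϖ) = W.w π ^ k)
    (hc : IsPrimitiveRoot c e) (hcπ : W.w (c - σ π / π) < 1) : e ∣ k := by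
  have hϖ := W.w_ϖ_pos
  have hwk : W.w (π ^ k) ≠ 0 := by rw [map_pow, ← hk]; exact hϖ.ne'
  have hπk : π ^ k ≠ 0 := (Valuation.ne_zero_iff W.w).1 hwk
  rw [← hc.pow_eq_one_iff_dvd]
  refine W.w.rootOfUnity_eq_one_of_sub_lt_one he (by rw [← pow_mul, mul_comm, pow_mul,
    hc.pow_eq_one, one_pow]) ?_
  have hle : W.w (σ π / π) ≤ 1 := by
    rw [map_div₀, W.map_galois]; exact div_self_le_one _
  have h1 := W.w.pow_sub_pow_lt_one hcπ hle k
  refine W.w.sub_lt_one_trans h1 ?_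
  -- `u` is a unit, hence fixed by `σ` up to a principal unit
  set u := π ^ k / algebraMap F Ω W.ϖ with hu
  have hu1 : W.w u = 1 := by rw [hu, map_div₀, map_pow, hk, div_self (hk ▸ hϖ.ne')]
  have hu0 : u ≠ 0 := by intro h; rw [h, map_zero] at hu1; exact zero_ne_one hu1
  have h2 : (σ π / π) ^ k - 1 = (σ u - u) / u := by
    have h3 := W.algebraMap_ϖ_ne_zero
    rw [hu, map_div₀, AlgEquiv.commutes, map_pow, div_pow]
    field_simp
  rw [h2, map_div₀, hu1, div_one]
  exact hσ u hu1.le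

end Hom

section Existence

variable [IsAlgClosed Ω] [IsGalois F Ω] {G : Type*} [Group G]

/-- A Frobenius automorphism may be corrected by an inertia automorphism to fix `β`. -/
theorem exists_frobenius_fixing {e : ℕ} {β : Ω} (hβ : β ^ e = algebraMap F Ω W.ϖ)
    (he : W.w (e : Ω) = 1) :
    ∃ s : Gal(Ω/F), (∀ x, W.w x ≤ 1 → W.w (s x - x ^ W.q) < 1) ∧ s β = β := by
  have he0 : e ≠ 0 := by rintro rfl; simp at he
  have hβ0 := W.ne_zero_of_pow_eq_ϖ hβ he0
  obtain ⟨s, hs⟩ := W.exists_frobenius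
  have hc := W.div_pow_eq_one hβ s
  obtain ⟨τ, hτ, hτβ⟩ := W.exists_inertia_eq_mul hβ he (ζ := (s β / β)⁻¹)
    (by rw [inv_pow, hc, inv_one])
  refine ⟨τ * s, fun x hx => ?_, ?_⟩
  · exact W.w.sub_lt_one_trans (y := s x) (hτ (s x) (by rwa [W.map_galois])) (hs x hx)
  · have h1 : τ (s β / β) = s β / β := W.inertia_fixes_rootOfUnity hτ he hc
    have h2 : s β / β ≠ 0 := div_ne_zero (by rwa [map_ne_zero]) hβ0
    rw [AlgEquiv.mul_apply, ← div_mul_cancel₀ (s β) hβ0, map_mul, h1, hτβ, mul_inv_cancel_left₀ h2]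

/-- The tame quotient of the Galois group: elements `a` of order dividing `e` and `b` of a finite
group with `b a b⁻¹ = a ^ q` are the images of a generator of tame inertia and of a Frobenius
automorphism. The homomorphism sends `σ` to `a ^ i * b ^ d` where `σ β = ζ ^ i β` and
`σ ξ = ξ ^ (q ^ d)` for a root of unity `ξ` of sufficiently divisible order `q ^ n - 1`. -/
theorem exists_continuousMonoidHom [Finite G] [TopologicalSpace G] [DiscreteTopology G] {e : ℕ}
    {β ζ : Ω} (hβ : β ^ e = algebraMap F Ω W.ϖ) (he : W.w (e : Ω) = 1) (hζ : IsPrimitiveRoot ζ e)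
    {s : Gal(Ω/F)} (hs : ∀ x, W.w x ≤ 1 → W.w (s x - x ^ W.q) < 1) (hsβ : s β = β)
    {a b : G} (ha : a ^ e = 1) (hab : b * a * b⁻¹ = a ^ W.q) :
    ∃ f : Gal(Ω/F) →ₜ* G, f s = b ∧
      ∀ σ ∈ W.inertia, ∀ i : ℕ, σ β = ζ ^ i * β → f σ = a ^ i := by
  have he0 : e ≠ 0 := by rintro rfl; simp at he
  have : NeZero e := ⟨he0⟩
  have hβ0 := W.ne_zero_of_pow_eq_ϖ hβ he0
  obtain ⟨n₀, hn₀, hζn₀⟩ := W.exists_pow_q_pow_sub_one_eq_one he hζ.pow_eq_one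
  -- `ξ` has to generate `ζ`, and `d` modulo `n` has to determine `b ^ d`
  set n := n₀ * orderOf b with hn
  have hn0 : n ≠ 0 := mul_ne_zero hn₀ (orderOf_pos b).ne'
  obtain ⟨ξ, hξ⟩ := W.exists_isPrimitiveRoot (W.w_q_pow_sub_one hn0)
  have : NeZero (W.q ^ n - 1) := ⟨W.q_pow_sub_one_ne_zero hn0⟩
  obtain ⟨l, -, hl⟩ : ∃ l < W.q ^ n - 1, ξ ^ l = ζ := by
    refine hξ.eq_pow_of_pow_eq_one ?_
    obtain ⟨c, hc⟩ := Nat.pow_sub_one_dvd_pow_sub_one W.q (⟨orderOf b, hn⟩ : n₀ ∣ n)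
    rw [hc, pow_mul, hζn₀, one_pow]
  have hi : ∀ σ : Gal(Ω/F), ∃ i : ℕ, σ β = ζ ^ i * β := fun σ => by
    obtain ⟨i, -, hi⟩ := hζ.eq_pow_of_pow_eq_one (W.div_pow_eq_one hβ σ)
    exact ⟨i, by rw [hi, div_mul_cancel₀ _ hβ0]⟩
  choose i hi using hi
  have hd : ∀ σ : Gal(Ω/F), ∃ d : ℕ, σ ξ = ξ ^ (W.q ^ d) := fun σ => by
    obtain ⟨d, -, hd⟩ := W.exists_galois_eq_pow hn0 hξ.pow_eq_one σ
    exact ⟨d, hd⟩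
  choose d hd using hd
  have hσζ : ∀ σ : Gal(Ω/F), σ ζ = ζ ^ (W.q ^ d σ) := fun σ => by
    rw [← hl, map_pow, hd, ← pow_mul, ← pow_mul, mul_comm]
  have hapow : ∀ {j k : ℕ}, ζ ^ j * β = ζ ^ k * β → a ^ j = a ^ k := fun {j k} h => by
    have h1 := mul_right_cancel₀ hβ0 h
    have hζu : IsUnit ζ := hζ.isUnit he0
    have h2 : j ≡ k [MOD e] := by
      obtain ⟨u, rfl⟩ := hζu
      rw [(IsPrimitiveRoot.coe_units_iff.1 hζ).eq_orderOf]
      refine pow_eq_pow_iff_modEq.1 (Units.ext ?_)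
      simpa using h1
    exact pow_eq_pow_iff_modEq.2 (h2.of_dvd (orderOf_dvd_of_pow_eq_one ha))
  have hbpow : ∀ {j k : ℕ}, ξ ^ (W.q ^ j) = ξ ^ (W.q ^ k) → b ^ j = b ^ k := fun {j k} h => by
    have h2 : W.q ^ j ≡ W.q ^ k [MOD W.q ^ n - 1] := by
      obtain ⟨u, hu⟩ := hξ.isUnit (NeZero.ne _)
      rw [← hu] at hξ h
      rw [(IsPrimitiveRoot.coe_units_iff.1 hξ).eq_orderOf]
      refine pow_eq_pow_iff_modEq.1 (Units.ext ?_)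
      simpa using h
    exact pow_eq_pow_iff_modEq.2
      ((Nat.pow_pow_modEq_cancel W.one_lt_q hn0 h2).of_dvd ⟨n₀, by rw [hn, mul_comm]⟩)
  have hconj : ∀ j k : ℕ, b ^ j * a ^ k = a ^ (W.q ^ j * k) * b ^ j := by
    intro j k
    induction j with
    | zero => simp
    | succ j ih =>
      have h1 : ∀ m : ℕ, b * a ^ m = a ^ (W.q * m) * b := fun m => by
        rw [pow_mul, ← hab, conj_pow]
        group
      rw [pow_succ' b, mul_assoc, ih, ← mul_assoc, h1, mul_assoc, pow_succ' W.q, mul_assoc]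
  let f₀ : Gal(Ω/F) →* G := MonoidHom.mk' (fun σ => a ^ i σ * b ^ d σ) fun σ τ => by
    have h1 : a ^ i (σ * τ) = a ^ (i σ + W.q ^ d σ * i τ) := hapow <| by
      rw [← hi, AlgEquiv.mul_apply, hi τ, map_mul, map_pow, hσζ, hi σ, ← pow_mul, ← mul_assoc,
        ← pow_add, add_comm]
    have h2 : b ^ d (σ * τ) = b ^ (d σ + d τ) := hbpow <| by
      rw [← hd, AlgEquiv.mul_apply, hd τ, map_pow, hd σ, ← pow_mul, ← pow_add]
    rw [h1, h2, mul_assoc, ← mul_assoc (b ^ d σ), hconj, pow_add, pow_add]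
    simp only [mul_assoc]
  have hf₀ : ∀ (σ : Gal(Ω/F)) (j k : ℕ), σ β = ζ ^ j * β → σ ξ = ξ ^ (W.q ^ k) →
      f₀ σ = a ^ j * b ^ k := fun σ j k hj hk => by
    change a ^ i σ * b ^ d σ = _
    rw [hapow ((hi σ).symm.trans hj), hbpow ((hd σ).symm.trans hk)]
  have hcont : Continuous f₀ := by
    set E : IntermediateField F Ω := IntermediateField.adjoin F {β, ξ} with hE
    have : FiniteDimensional F E := IntermediateField.finiteDimensional_adjoin fun x _ =>
      Algebra.IsIntegral.isIntegral x
    refine continuous_of_continuousAt_one f₀ ?_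
    rw [ContinuousAt, map_one, nhds_discrete G, Filter.tendsto_pure]
    filter_upwards [E.fixingSubgroup_isOpen.mem_nhds (one_mem _)] with σ hσ
    have hσ' : ∀ x ∈ E, σ x = x := fun x hx => hσ ⟨x, hx⟩
    rw [hf₀ σ 0 0]
    · simp
    · rw [hσ' β (IntermediateField.subset_adjoin F _ (by simp))]; simp
    · rw [hσ' ξ (IntermediateField.subset_adjoin F _ (by simp))]; simp
  refine ⟨⟨f₀, hcont⟩, ?_, fun σ hσ j hj => ?_⟩
  · have := hf₀ s 0 1 (by rw [hsβ]; simp)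
      (by rw [W.frobenius_rootOfUnity hs (W.w_q_pow_sub_one hn0) hξ.pow_eq_one, pow_one])
    rw [pow_zero, one_mul, pow_one] at this
    exact this
  · have := hf₀ σ j 0 hj (by
      rw [W.inertia_fixes_rootOfUnity hσ (W.w_q_pow_sub_one hn0) hξ.pow_eq_one]; simp)
    rw [pow_zero, mul_one] at this
    exact this

end Existence

end LocalValuation

/-! ### The valuation defined by the spectral norm -/

theorem FiniteField.exists_pow_card_pow_eq {k L : Type*} [Field k] [Finite k] [Field L]
    [Algebra k L] [Algebra.IsAlgebraic k L] (c : L) : ∃ n : ℕ, n ≠ 0 ∧ c ^ (Nat.card k ^ n) = c := by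
  have hc : IsIntegral k c := Algebra.IsIntegral.isIntegral c
  have := IntermediateField.adjoin.finiteDimensional hc
  have : Finite (IntermediateField.adjoin k {c}) := Module.finite_of_finite k
  have := Fintype.ofFinite (IntermediateField.adjoin k {c})
  refine ⟨Module.finrank k (IntermediateField.adjoin k {c}), Module.finrank_pos.ne', ?_⟩
  rw [← Module.natCard_eq_pow_finrank (K := k), Nat.card_eq_fintype_card]
  exact congrArg Subtype.val
    (FiniteField.pow_card (⟨c, IntermediateField.mem_adjoin_simple_self k c⟩ :
      IntermediateField.adjoin k {c}))

theorem FiniteField.mem_range_of_pow_card_eq {k L : Type*} [Field k] [Finite k] [Field L]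
    [Algebra k L] {c : L} (h : c ^ Nat.card k = c) : c ∈ Set.range (algebraMap k L) := by
  classical
  have := Fintype.ofFinite k
  have hq : 1 < Fintype.card k := Fintype.one_lt_card
  by_contra hc
  have hne := FiniteField.X_pow_card_sub_X_ne_zero L hq
  have hsub : insert c (Finset.univ.image (algebraMap k L)) ⊆
      (Polynomial.X ^ Fintype.card k - Polynomial.X : Polynomial L).roots.toFinset := by
    intro x hx
    rw [Multiset.mem_toFinset, Polynomial.mem_roots hne, Polynomial.IsRoot.def,
      Polynomial.eval_sub, Polynomial.eval_pow, Polynomial.eval_X, sub_eq_zero]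
    rcases Finset.mem_insert.1 hx with rfl | hx
    · rwa [← Nat.card_eq_fintype_card]
    · obtain ⟨a, -, rfl⟩ := Finset.mem_image.1 hx
      rw [← map_pow, FiniteField.pow_card]
  have h1 := (Finset.card_le_card hsub).trans
    ((Multiset.toFinset_card_le _).trans (Polynomial.card_roots' _))
  rw [FiniteField.X_pow_card_sub_X_natDegree_eq L hq, Finset.card_insert_of_notMem
    (by simpa using hc), Finset.card_image_of_injective _ (algebraMap k L).injective,
    Finset.card_univ] at h1
  omega

section Spectral

variable (F Ω : Type*) [NontriviallyNormedField F] [IsUltrametricDist F] [CompleteSpace F]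
  [Field Ω] [Algebra F Ω] [Algebra.IsAlgebraic F Ω]

/-- The spectral norm of an algebraic extension of a complete nonarchimedean field, as a
valuation. -/
noncomputable def spectralValuation : Valuation Ω NNReal where
  toFun x := ⟨spectralNorm F Ω x, spectralNorm_nonneg x⟩
  map_zero' := NNReal.eq spectralNorm_zero
  map_one' := NNReal.eq spectralNorm_one
  map_mul' x y := NNReal.eq (spectralAlgNorm_mul x y)
  map_add_le_max' x y := isNonarchimedean_spectralNorm x y

variable {F Ω}

theorem coe_spectralValuation (x : Ω) : (spectralValuation F Ω x : ℝ) = spectralNorm F Ω x := rfl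

theorem coe_spectralValuation_algebraMap (a : F) :
    (spectralValuation F Ω (algebraMap F Ω a) : ℝ) = ‖a‖ := spectralNorm_extends a

theorem spectralValuation_galois (σ : Gal(Ω/F)) (x : Ω) :
    spectralValuation F Ω (σ x) = spectralValuation F Ω x :=
  NNReal.eq (spectralNorm_eq_of_equiv σ x).symm

variable (A : ValuationSubring F) (hA : ∀ x, x ∈ A ↔ ‖x‖ ≤ 1)

include hA

theorem mem_integralClosure_iff_spectralValuation_le_one (x : Ω) :
    x ∈ integralClosure A Ω ↔ spectralValuation F Ω x ≤ 1 :=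
  mem_integralClosure_iff_spectralNorm_le_one A hA x

variable (Ω) in
theorem mem_maximalIdeal_integralClosure_iff [hloc : IsLocalRing (integralClosure A Ω)]
    (b : integralClosure A Ω) : b ∈ IsLocalRing.maximalIdeal (integralClosure A Ω) ↔
      spectralValuation F Ω (b : Ω) < 1 := by
  have hmem := mem_integralClosure_iff_spectralValuation_le_one A hA (Ω := Ω)
  have hb := (hmem b).1 b.2
  rw [IsLocalRing.mem_maximalIdeal, mem_nonunits_iff, lt_iff_le_and_ne, and_iff_right hb, not_iff_not]
  constructor
  · rintro ⟨u, rfl⟩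
    refine le_antisymm hb ?_
    have h1 : ((u : integralClosure A Ω) : Ω) *
        ((u⁻¹ : (integralClosure A Ω)ˣ) : integralClosure A Ω) = 1 :=
      congrArg Subtype.val u.mul_inv
    rw [← (spectralValuation F Ω).map_one, ← h1, map_mul]
    exact mul_le_of_le_one_right'
      ((hmem _).1 ((u⁻¹ : (integralClosure A Ω)ˣ) : integralClosure A Ω).2)
  · intro h
    have h0 : (b : Ω) ≠ 0 := by
      intro h0
      rw [h0, map_zero] at h
      exact zero_ne_one h
    exact IsUnit.of_mul_eq_one ⟨(b : Ω)⁻¹, (hmem _).2 (by rw [map_inv₀, h, inv_one])⟩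
      (Subtype.ext (mul_inv_cancel₀ h0))

omit [IsUltrametricDist F] [CompleteSpace F] in
theorem mem_maximalIdeal_iff_norm_lt_one (a : A) :
    a ∈ IsLocalRing.maximalIdeal A ↔ ‖(a : F)‖ < 1 := by
  rw [ValuationSubring.valuation_lt_one_iff, lt_iff_le_not_ge, lt_iff_le_not_ge]
  have h1 : ∀ x : F, A.valuation x ≤ 1 ↔ ‖x‖ ≤ 1 := fun x => by
    rw [A.valuation_le_one_iff, hA]
  by_cases ha : (a : F) = 0
  · simp [ha]
  · have h2 := h1 (a : F)⁻¹
    rw [map_inv₀, norm_inv, inv_le_one₀ (by rwa [zero_lt_iff, Valuation.ne_zero_iff]),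
      inv_le_one₀ (by rwa [norm_pos_iff])] at h2
    rw [h1, h2]

omit hA [IsUltrametricDist F] [CompleteSpace F] [Algebra.IsAlgebraic F Ω] in
variable (Ω) in
/-- The Galois group acts on the integral closure with invariants the base ring. -/
theorem integralClosure_isInvariant [IsGalois F Ω] :
    Algebra.IsInvariant A (integralClosure A Ω) Gal(Ω/F) where
  isInvariant b hb := by
    obtain ⟨a, ha⟩ := (InfiniteGalois.mem_range_algebraMap_iff_fixed (k := F) (b : Ω)).2
      fun σ => congrArg Subtype.val (hb σ)
    have hint : IsIntegral A a := by
      rw [← isIntegral_algebraMap_iff (algebraMap F Ω).injective, ha]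
      exact b.2
    obtain ⟨a', rfl⟩ := IsIntegrallyClosed.isIntegral_iff.1 hint
    exact ⟨a', Subtype.ext ha⟩

variable (Ω) in
theorem maximalIdeal_liesOver [IsLocalRing (integralClosure A Ω)] :
    (IsLocalRing.maximalIdeal (integralClosure A Ω)).LiesOver (IsLocalRing.maximalIdeal A) := by
  refine ⟨Ideal.ext fun a => ?_⟩
  rw [Ideal.mem_comap, mem_maximalIdeal_integralClosure_iff Ω A hA,
    mem_maximalIdeal_iff_norm_lt_one A hA, ← coe_spectralValuation_algebraMap (Ω := Ω),
    ← NNReal.coe_lt_coe]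
  rfl

variable (Ω) in
attribute [local instance] Ideal.Quotient.field in
/-- The `q`-power map on the residue field lifts to the Galois group. -/
theorem exists_frobenius_spectralValuation [IsGalois F Ω] [Finite (IsLocalRing.ResidueField A)] :
    ∃ s : Gal(Ω/F), ∀ x : Ω, spectralValuation F Ω x ≤ 1 →
      spectralValuation F Ω (s x - x ^ Nat.card (IsLocalRing.ResidueField A)) < 1 := by
  have hloc := isLocalRing_integralClosure A hA Ω
  have := maximalIdeal_liesOver Ω A hA
  have := integralClosure_isInvariant Ω A
  -- the stabilizer of the maximal ideal of a profinite group acting continuously on the discrete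
  -- ring `integralClosure A Ω` surjects onto the automorphisms of the residue field
  let : TopologicalSpace (integralClosure A Ω) := ⊥
  have : DiscreteTopology (integralClosure A Ω) := ⟨rfl⟩
  have : ContinuousSMul Gal(Ω/F) (integralClosure A Ω) := by
    refine continuousSMul_iff_stabilizer_isOpen.2 fun b => ?_
    refine Subgroup.isOpen_mono (H₁ := MulAction.stabilizer Gal(Ω/F) (b : Ω)) (fun σ hσ => ?_)
      (stabilizer_isOpen_of_isIntegral (b : Ω))
    exact Subtype.ext hσ
  set P := IsLocalRing.maximalIdeal A
  set Q := IsLocalRing.maximalIdeal (integralClosure A Ω)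
  have : Finite (A ⧸ P) := ‹Finite (IsLocalRing.ResidueField A)›
  have := Fintype.ofFinite (A ⧸ P)
  have : Algebra.IsIntegral (A ⧸ P) (integralClosure A Ω ⧸ Q) :=
    Ideal.Quotient.algebra_isIntegral_of_liesOver Q P
  have : Algebra.IsAlgebraic (A ⧸ P) (integralClosure A Ω ⧸ Q) := Algebra.IsIntegral.isAlgebraic
  obtain ⟨s, hs⟩ := Ideal.Quotient.stabilizerHom_surjective_of_profinite (G := Gal(Ω/F)) P Q
    (FiniteField.frobeniusAlgEquivOfAlgebraic (A ⧸ P) (integralClosure A Ω ⧸ Q))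
  refine ⟨s, fun x hx => ?_⟩
  rw [← mem_integralClosure_iff_spectralValuation_le_one A hA] at hx
  have h1 := DFunLike.congr_fun hs (Ideal.Quotient.mk Q ⟨x, hx⟩)
  rw [FiniteField.coe_frobeniusAlgEquivOfAlgebraic] at h1
  simp only [Ideal.Quotient.stabilizerHom_apply, ← map_pow] at h1
  rw [Ideal.Quotient.eq, mem_maximalIdeal_integralClosure_iff Ω A hA] at h1
  rw [← Nat.card_eq_fintype_card] at h1
  exact h1

variable (Ω) in
attribute [local instance] Ideal.Quotient.field in
theorem exists_pow_sub_lt_one_spectralValuation [Finite (IsLocalRing.ResidueField A)] (x : Ω)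
    (hx : spectralValuation F Ω x ≤ 1) : ∃ n : ℕ, n ≠ 0 ∧
      spectralValuation F Ω (x ^ (Nat.card (IsLocalRing.ResidueField A) ^ n) - x) < 1 := by
  have hloc := isLocalRing_integralClosure A hA Ω
  have := maximalIdeal_liesOver Ω A hA
  set P := IsLocalRing.maximalIdeal A
  set Q := IsLocalRing.maximalIdeal (integralClosure A Ω)
  have : Finite (A ⧸ P) := ‹Finite (IsLocalRing.ResidueField A)›
  have : Algebra.IsIntegral (A ⧸ P) (integralClosure A Ω ⧸ Q) :=
    Ideal.Quotient.algebra_isIntegral_of_liesOver Q P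
  have : Algebra.IsAlgebraic (A ⧸ P) (integralClosure A Ω ⧸ Q) := Algebra.IsIntegral.isAlgebraic
  rw [← mem_integralClosure_iff_spectralValuation_le_one A hA] at hx
  obtain ⟨n, hn, h⟩ :=
    FiniteField.exists_pow_card_pow_eq (k := A ⧸ P) (Ideal.Quotient.mk Q ⟨x, hx⟩)
  refine ⟨n, hn, ?_⟩
  rw [← map_pow, Ideal.Quotient.eq, mem_maximalIdeal_integralClosure_iff Ω A hA] at h
  exact h

variable (Ω) in
attribute [local instance] Ideal.Quotient.field in
theorem exists_residue_spectralValuation [Finite (IsLocalRing.ResidueField A)] (x : Ω)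
    (hx : spectralValuation F Ω x ≤ 1)
    (h : spectralValuation F Ω (x ^ Nat.card (IsLocalRing.ResidueField A) - x) < 1) :
    ∃ a : F, spectralValuation F Ω (x - algebraMap F Ω a) < 1 := by
  have hloc := isLocalRing_integralClosure A hA Ω
  have := maximalIdeal_liesOver Ω A hA
  set P := IsLocalRing.maximalIdeal A
  set Q := IsLocalRing.maximalIdeal (integralClosure A Ω)
  have : Finite (A ⧸ P) := ‹Finite (IsLocalRing.ResidueField A)›
  rw [← mem_integralClosure_iff_spectralValuation_le_one A hA] at hx
  have h1 : Ideal.Quotient.mk Q ⟨x, hx⟩ ^ Nat.card (A ⧸ P) = Ideal.Quotient.mk Q ⟨x, hx⟩ := by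
    rw [← map_pow, Ideal.Quotient.eq, mem_maximalIdeal_integralClosure_iff Ω A hA]
    exact h
  obtain ⟨a, ha⟩ := FiniteField.mem_range_of_pow_card_eq (k := A ⧸ P)
    (L := integralClosure A Ω ⧸ Q) h1
  obtain ⟨a, rfl⟩ := Ideal.Quotient.mk_surjective a
  rw [Ideal.Quotient.algebraMap_mk_of_liesOver, eq_comm, Ideal.Quotient.eq,
    mem_maximalIdeal_integralClosure_iff Ω A hA] at ha
  exact ⟨a, ha⟩

omit [IsUltrametricDist F] [CompleteSpace F] in
theorem exists_norm_eq_zpow [IsDiscreteValuationRing A] {ϖ : A} (hϖ : Irreducible ϖ) {a : F}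
    (ha : a ≠ 0) : ∃ k : ℤ, ‖a‖ = ‖(ϖ : F)‖ ^ k := by
  have hunit : ∀ u : Aˣ, ‖((u : A) : F)‖ = 1 := fun u => by
    refine le_antisymm ((hA _).1 (u : A).2) (not_lt.1 ?_)
    rw [← mem_maximalIdeal_iff_norm_lt_one A hA, IsLocalRing.mem_maximalIdeal, mem_nonunits_iff,
      not_not]
    exact u.isUnit
  have key : ∀ x : A, x ≠ 0 → ∃ k : ℤ, ‖(x : F)‖ = ‖(ϖ : F)‖ ^ k := fun x hx => by
    obtain ⟨n, u, rfl⟩ := IsDiscreteValuationRing.eq_unit_mul_pow_irreducible hx hϖ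
    refine ⟨n, ?_⟩
    push_cast
    rw [norm_mul, hunit, one_mul, norm_pow, zpow_natCast]
  rcases A.mem_or_inv_mem a with h | h
  · exact key ⟨a, h⟩ (fun h0 => ha (congrArg Subtype.val h0))
  · obtain ⟨k, hk⟩ := key ⟨a⁻¹, h⟩ (fun h0 => inv_ne_zero ha (congrArg Subtype.val h0))
    refine ⟨-k, ?_⟩
    rw [zpow_neg, ← hk, norm_inv, inv_inv]

variable (Ω) in
/-- The local valuation given by the spectral norm of a Galois extension `Ω` of a complete field
`F` whose valuation ring `A` is discrete with finite residue field. -/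
noncomputable def LocalValuation.ofComplete [IsGalois F Ω] [IsDiscreteValuationRing A]
    [Finite (IsLocalRing.ResidueField A)] {ϖ : A} (hϖ : Irreducible ϖ) : LocalValuation F Ω where
  w := spectralValuation F Ω
  map_galois := spectralValuation_galois
  q := Nat.card (IsLocalRing.ResidueField A)
  one_lt_q := Finite.one_lt_card
  w_q_lt_one := by
    have := Fintype.ofFinite (IsLocalRing.ResidueField A)
    have h0 : IsLocalRing.residue A (Nat.card (IsLocalRing.ResidueField A) : A) = 0 := by
      rw [map_natCast, Nat.card_eq_fintype_card, Nat.cast_card_eq_zero]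
    rw [IsLocalRing.residue_eq_zero_iff, mem_maximalIdeal_iff_norm_lt_one A hA] at h0
    rw [← map_natCast (algebraMap F Ω), ← NNReal.coe_lt_coe, coe_spectralValuation_algebraMap]
    exact_mod_cast h0
  ϖ := ϖ
  ϖ_ne_zero := fun h => hϖ.ne_zero (Subtype.ext h)
  w_ϖ_lt_one := by
    rw [← NNReal.coe_lt_coe, coe_spectralValuation_algebraMap]
    exact (mem_maximalIdeal_iff_norm_lt_one A hA ϖ).1
      ((IsLocalRing.mem_maximalIdeal _).2 hϖ.not_isUnit)
  exists_zpow a ha := by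
    obtain ⟨k, hk⟩ := exists_norm_eq_zpow A hA hϖ ha
    refine ⟨k, NNReal.eq ?_⟩
    rw [NNReal.coe_zpow, coe_spectralValuation_algebraMap, coe_spectralValuation_algebraMap, hk]
  exists_pow_sub_lt_one x hx := exists_pow_sub_lt_one_spectralValuation Ω A hA x hx.le
  exists_residue := exists_residue_spectralValuation Ω A hA
  exists_frobenius := exists_frobenius_spectralValuation Ω A hA

variable (F Ω) in
omit [Algebra.IsAlgebraic F Ω] in
theorem isDiscreteValuationRing_integralClosure [FiniteDimensional F Ω] [Algebra.IsSeparable F Ω]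
    [IsDiscreteValuationRing A] : IsDiscreteValuationRing (integralClosure A Ω) := by
  have := isLocalRing_integralClosure A hA Ω
  have : IsDedekindDomain (integralClosure A Ω) := integralClosure.isDedekindDomain A F Ω
  have hA0 : ¬IsField A := IsDiscreteValuationRing.not_isField A
  have hinj : Function.Injective (algebraMap A (integralClosure A Ω)) := fun a b h =>
    Subtype.ext ((algebraMap F Ω).injective (congrArg Subtype.val h))
  have hint : Algebra.IsIntegral A (integralClosure A Ω) := integralClosure.AlgebraIsIntegral
  have hnf : ¬IsField (integralClosure A Ω) := fun h =>
    hA0 (isField_of_isIntegral_of_isField hinj h)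
  exact ((IsDiscreteValuationRing.TFAE (integralClosure A Ω) hnf).out 0 2).2 this

section Finite

variable (L : IntermediateField F Ω) [FiniteDimensional F L] [Algebra.IsSeparable F L]
  [IsDiscreteValuationRing A]

omit [Algebra.IsAlgebraic F Ω] in
theorem exists_irreducible_integralClosure : ∃ π : integralClosure A L, Irreducible π :=
  have := isDiscreteValuationRing_integralClosure F L A hA
  IsDiscreteValuationRing.exists_irreducible _

variable {L} {π : integralClosure A L} (hπ : Irreducible π)

include hπ

theorem spectralValuation_lt_one_of_irreducible :
    spectralValuation F Ω ((π : L) : Ω) < 1 := by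
  have := isDiscreteValuationRing_integralClosure F L A hA
  have h1 := (mem_maximalIdeal_integralClosure_iff L A hA π).1
    ((IsLocalRing.mem_maximalIdeal _).2 hπ.not_isUnit)
  rw [← NNReal.coe_lt_coe, coe_spectralValuation] at h1 ⊢
  rwa [spectralNorm.eq_of_tower (L := Ω)] at h1

theorem exists_spectralValuation_eq_pow (z : L) (hz0 : z ≠ 0)
    (hz : spectralValuation F Ω (z : Ω) ≤ 1) :
    ∃ k : ℕ, spectralValuation F Ω (z : Ω) = spectralValuation F Ω ((π : L) : Ω) ^ k := by
  have := isDiscreteValuationRing_integralClosure F L A hA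
  have hL : ∀ x : L, spectralValuation F Ω (x : Ω) = spectralValuation F L x := fun x =>
    NNReal.eq (spectralNorm.eq_of_tower (L := Ω) x).symm
  rw [hL, ← mem_integralClosure_iff_spectralValuation_le_one A hA] at hz
  obtain ⟨n, u, hu⟩ := IsDiscreteValuationRing.eq_unit_mul_pow_irreducible
    (x := (⟨z, hz⟩ : integralClosure A L)) (fun h => hz0 (congrArg Subtype.val h)) hπ
  have hu1 : spectralValuation F L ((u : integralClosure A L) : L) = 1 := by
    refine le_antisymm ((mem_integralClosure_iff_spectralValuation_le_one A hA _).1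
      (u : integralClosure A L).2) (not_lt.1 ?_)
    rw [← mem_maximalIdeal_integralClosure_iff L A hA, IsLocalRing.mem_maximalIdeal,
      mem_nonunits_iff, not_not]
    exact u.isUnit
  refine ⟨n, ?_⟩
  have h1 : z = ((u : integralClosure A L) : L) * (π : L) ^ n := congrArg Subtype.val hu
  rw [hL, hL, h1, map_mul, hu1, one_mul, map_pow]

theorem exists_spectralValuation_eq_zpow (z : L) (hz0 : z ≠ 0) :
    ∃ k : ℤ, spectralValuation F Ω (z : Ω) = spectralValuation F Ω ((π : L) : Ω) ^ k := by
  rcases le_total (spectralValuation F Ω (z : Ω)) 1 with h | h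
  · obtain ⟨k, hk⟩ := exists_spectralValuation_eq_pow A hA hπ z hz0 h
    exact ⟨k, by rw [hk, zpow_natCast]⟩
  · obtain ⟨k, hk⟩ := exists_spectralValuation_eq_pow A hA hπ z⁻¹ (inv_ne_zero hz0)
      (by push_cast; rw [map_inv₀]; exact inv_le_one_of_one_le₀ h)
    refine ⟨-k, ?_⟩
    rw [zpow_neg, zpow_natCast, ← hk]
    push_cast
    rw [map_inv₀, inv_inv]

end Finite

end Spectral

/-! ### Completions of number fields -/

section NumberField

variable {K : Type*} [Field K] [NumberField K] (v : HeightOneSpectrum (𝓞 K))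

instance : CharZero (v.adicCompletion K) :=
  charZero_of_injective_algebraMap (algebraMap K _).injective

attribute [local instance] Valued.toNontriviallyNormedField

theorem mem_adicCompletionIntegers_iff_norm_le_one (x : v.adicCompletion K) :
    x ∈ v.adicCompletionIntegers K ↔ ‖x‖ ≤ 1 :=
  (HeightOneSpectrum.mem_adicCompletionIntegers (𝓞 K) K v).trans
    Valued.toNormedField.norm_le_one_iff.symm

theorem norm_algebraMap_lt_one_iff (r : 𝓞 K) :
    ‖algebraMap K (v.adicCompletion K) r‖ < 1 ↔ r ∈ v.asIdeal := by
  rw [Valued.toNormedField.norm_lt_one_iff, ← v.valuation_lt_one_iff_mem (K := K)]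
  exact iff_of_eq (congrArg (· < 1) (HeightOneSpectrum.valuedAdicCompletion_eq_valuation v r))

/-- The ring of integers of `K` has the same residue field at `v` as its completion. -/
theorem natCard_residueField_adicCompletionIntegers :
    Nat.card (IsLocalRing.ResidueField (v.adicCompletionIntegers K)) =
      Nat.card (𝓞 K ⧸ v.asIdeal) := by
  set φ := (IsLocalRing.residue (v.adicCompletionIntegers K)).comp
    (algebraMap (𝓞 K) (v.adicCompletionIntegers K)) with hφ
  have hA := mem_adicCompletionIntegers_iff_norm_le_one v
  have hsurj : Function.Surjective φ := by
    intro c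
    obtain ⟨x, rfl⟩ := IsLocalRing.residue_surjective c
    obtain ⟨k, hk⟩ := (HeightOneSpectrum.denseRange_algebraMap K v).exists_dist_lt
      (x : v.adicCompletion K) one_pos
    rw [dist_eq_norm] at hk
    have hk1 : v.valuation K k ≤ 1 := by
      rw [← HeightOneSpectrum.valuedAdicCompletion_eq_valuation',
        ← Valued.toNormedField.norm_le_one_iff]
      have h1 := (hA _).1 x.2
      have h2 := IsUltrametricDist.norm_add_le_max (x : v.adicCompletion K)
        (-(x - algebraMap K (v.adicCompletion K) k))
      rw [← sub_eq_add_neg, sub_sub_cancel, norm_neg] at h2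
      exact h2.trans (max_le h1 hk.le)
    obtain ⟨r, hr⟩ := v.exists_valuation_sub_lt_of_integer hk1 1
    refine ⟨r, ?_⟩
    rw [hφ, RingHom.comp_apply, ← sub_eq_zero, ← map_sub, IsLocalRing.residue_eq_zero_iff,
      mem_maximalIdeal_iff_norm_lt_one _ hA]
    have h3 : ‖algebraMap K (v.adicCompletion K) (r - k)‖ < 1 := by
      rw [Valued.toNormedField.norm_lt_one_iff]
      exact lt_of_eq_of_lt (HeightOneSpectrum.valuedAdicCompletion_eq_valuation' v _) hr
    have h4 : ((algebraMap (𝓞 K) (v.adicCompletionIntegers K) r - x : v.adicCompletionIntegers K) :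
        v.adicCompletion K) = algebraMap K (v.adicCompletion K) (r - k) -
          (x - algebraMap K (v.adicCompletion K) k) := by
      rw [map_sub, sub_sub_sub_cancel_right]
      rfl
    rw [h4, sub_eq_add_neg]
    refine (IsUltrametricDist.norm_add_le_max _ _).trans_lt (max_lt h3 ?_)
    rwa [norm_neg]
  have hker : RingHom.ker φ = v.asIdeal := by
    ext r
    rw [RingHom.mem_ker, hφ, RingHom.comp_apply, IsLocalRing.residue_eq_zero_iff,
      mem_maximalIdeal_iff_norm_lt_one _ hA, ← norm_algebraMap_lt_one_iff]
    rfl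
  rw [← hker]
  exact Nat.card_congr (RingHom.quotientKerEquivOfSurjective hsurj).symm.toEquiv

instance : Finite (IsLocalRing.ResidueField (v.adicCompletionIntegers K)) := by
  refine Nat.finite_of_card_ne_zero ?_
  rw [natCard_residueField_adicCompletionIntegers]
  exact Nat.card_pos.ne'

/-- The valuation on the algebraic closure of the completion `K_v`. -/
noncomputable def localValuation : LocalValuation (v.adicCompletion K) (LocalClosure v) :=
  LocalValuation.ofComplete (LocalClosure v) (v.adicCompletionIntegers K)
    (mem_adicCompletionIntegers_iff_norm_le_one v)
    (IsDiscreteValuationRing.exists_irreducible (v.adicCompletionIntegers K)).choose_spec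

theorem localValuation_q : (localValuation v).q = Nat.card (𝓞 K ⧸ v.asIdeal) :=
  natCard_residueField_adicCompletionIntegers v

theorem mem_localIntegers_iff (x : LocalClosure v) :
    x ∈ integralClosure (v.adicCompletionIntegers K) (LocalClosure v) ↔
      (localValuation v).w x ≤ 1 :=
  mem_integralClosure_iff_spectralValuation_le_one (v.adicCompletionIntegers K)
    (mem_adicCompletionIntegers_iff_norm_le_one v) x

theorem mem_maximalIdeal_localIntegers_iff (b : LocalIntegers v) :
    b ∈ IsLocalRing.maximalIdeal (LocalIntegers v) ↔ (localValuation v).w (b : LocalClosure v) < 1 :=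
  mem_maximalIdeal_integralClosure_iff (hloc := instIsLocalRingLocalIntegers v) (LocalClosure v)
    (v.adicCompletionIntegers K) (mem_adicCompletionIntegers_iff_norm_le_one v) b

theorem exists_mem_maximalIdeal_iff (x : LocalClosure v) :
    (∃ m ∈ IsLocalRing.maximalIdeal (LocalIntegers v), x = (m : LocalClosure v)) ↔
      (localValuation v).w x < 1 := by
  constructor
  · rintro ⟨m, hm, rfl⟩
    exact (mem_maximalIdeal_localIntegers_iff v m).1 hm
  · intro h
    exact ⟨⟨x, (mem_localIntegers_iff v x).2 h.le⟩,
      (mem_maximalIdeal_localIntegers_iff v _).2 h, rfl⟩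

theorem localInertia_eq : localInertia v = (localValuation v).inertia := by
  have hsmul : ∀ (σ : LocalGaloisGroup v) (b : LocalIntegers v),
      σ • b - b ∈ IsLocalRing.maximalIdeal (LocalIntegers v) ↔
        (localValuation v).w (σ (b : LocalClosure v) - b) < 1 := fun σ b =>
    mem_maximalIdeal_localIntegers_iff v (σ • b - b)
  ext σ
  rw [LocalValuation.mem_inertia, localInertia]
  refine (AddSubgroup.mem_inertia (G := LocalGaloisGroup v)).trans ?_
  refine ⟨fun h x hx => ?_, fun h b => ?_⟩
  · exact (hsmul σ ⟨x, (mem_localIntegers_iff v x).2 hx⟩).1 (h _)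
  · exact (hsmul σ b).2 (h b ((mem_localIntegers_iff v b).1 b.2))

theorem localValuation_natCast_eq_one {e : ℕ} (he : (e : 𝓞 K) ∉ v.asIdeal) :
    (localValuation v).w (e : LocalClosure v) = 1 := by
  refine le_antisymm ((localValuation v).w.natCast_le_one e) (not_lt.1 fun h => he ?_)
  have h1 : algebraMap K (v.adicCompletion K) ((e : 𝓞 K) : K) = (e : v.adicCompletion K) := by
    rw [← map_natCast (algebraMap K (v.adicCompletion K)) e]
    rfl
  rw [← norm_algebraMap_lt_one_iff, h1,
    ← coe_spectralValuation_algebraMap (Ω := LocalClosure v), map_natCast]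
  exact_mod_cast h

variable {v} {G : Type*} [Group G] [TopologicalSpace G] [DiscreteTopology G]
  (f : LocalGaloisGroup v →ₜ* G)

theorem isOpen_ker : IsOpen (f.toMonoidHom.ker : Set (LocalGaloisGroup v)) := by
  have : (f.toMonoidHom.ker : Set (LocalGaloisGroup v)) = f ⁻¹' {1} := by
    ext σ
    exact Iff.rfl
  rw [this]
  exact (isOpen_discrete _).preimage f.continuous_toFun

theorem fixingSubgroup_kernelField : (kernelField f).fixingSubgroup = f.toMonoidHom.ker :=
  InfiniteGalois.fixingSubgroup_fixedField
    (⟨f.toMonoidHom.ker, Subgroup.isClosed_of_isOpen _ (isOpen_ker f)⟩ :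
      ClosedSubgroup (LocalGaloisGroup v))

instance : FiniteDimensional (v.adicCompletion K) (kernelField f) := by
  refine (InfiniteGalois.isOpen_iff_finite (kernelField f)).1 ?_
  rw [fixingSubgroup_kernelField]
  exact isOpen_ker f

theorem exists_uniformizer_kernelField :
    ∃ π : integralClosure (v.adicCompletionIntegers K) (kernelField f), Irreducible π :=
  exists_irreducible_integralClosure _ (mem_adicCompletionIntegers_iff_norm_le_one v) _

variable {f} {π : integralClosure (v.adicCompletionIntegers K) (kernelField f)}
  (hπ : Irreducible π)

include hπ

theorem localValuation_uniformizer_lt_one :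
    (localValuation v).w ((π : kernelField f) : LocalClosure v) < 1 :=
  spectralValuation_lt_one_of_irreducible _ (mem_adicCompletionIntegers_iff_norm_le_one v) hπ

theorem exists_localValuation_eq_zpow {z : LocalClosure v} (hz : z ∈ kernelField f) (hz0 : z ≠ 0) :
    ∃ k : ℤ, (localValuation v).w z =
      (localValuation v).w ((π : kernelField f) : LocalClosure v) ^ k :=
  exists_spectralValuation_eq_zpow _ (mem_adicCompletionIntegers_iff_norm_le_one v) hπ ⟨z, hz⟩
    (fun h => hz0 (congrArg Subtype.val h))

theorem exists_localValuation_ϖ_eq_pow :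
    ∃ k : ℕ, (localValuation v).w (algebraMap _ (LocalClosure v) (localValuation v).ϖ) =
      (localValuation v).w ((π : kernelField f) : LocalClosure v) ^ k :=
  exists_spectralValuation_eq_pow _ (mem_adicCompletionIntegers_iff_norm_le_one v) hπ
    (algebraMap _ (kernelField f) (localValuation v).ϖ)
    (by rw [map_ne_zero]; exact (localValuation v).ϖ_ne_zero) (localValuation v).w_ϖ_lt_one.le

end NumberField

/-! ### Counting in commuting group actions -/

section Counting

variable {G U X : Type*} [Group G] [Group U] [MulAction G X] [MulAction U X] [SMulCommClass G U X]

omit [SMulCommClass G U X] in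
/-- If `A` is the stabilizer in `U` of the `G`-orbit of `x`, then the stabilizer of `x` in `G × U`
is an extension of `A` by the stabilizer of `x` in `G`. -/
theorem natCard_stabilizer_prod (x : X) (A : Subgroup U)
    (hA : ∀ u, u ∈ A ↔ ∃ g : G, u • x = g • x) :
    Nat.card {p : G × U // p.1 • p.2 • x = x} = Nat.card A * Nat.card (MulAction.stabilizer G x) := by
  choose h hh using fun u : A => (hA u).1 u.2
  rw [← Nat.card_prod]
  refine (Nat.card_congr ?_).symm
  exact
    { toFun := fun p => ⟨((p.2 : G) * (h p.1)⁻¹, p.1), by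
        change ((p.2 : G) * (h p.1)⁻¹) • (p.1 : U) • x = x
        rw [hh, smul_smul, inv_mul_cancel_right]
        exact p.2.2⟩
      invFun := fun p =>
        have hp : p.1.2 ∈ A := (hA _).2 ⟨p.1.1⁻¹, by rw [eq_inv_smul_iff]; exact p.2⟩
        (⟨p.1.2, hp⟩, ⟨p.1.1 * h ⟨p.1.2, hp⟩, by
          rw [MulAction.mem_stabilizer_iff, mul_smul, ← hh]
          exact p.2⟩)
      left_inv := fun p => Prod.ext rfl (Subtype.ext (inv_mul_cancel_right _ _))
      right_inv := fun p => Subtype.ext (Prod.ext (mul_inv_cancel_right _ _) rfl) }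

/-- Let `A` be the stabilizer in `U` of the `G`-orbit of `x`. The `G × U`-orbit of `x` consists of
`[U : A]` orbits of `G`, each of which is preserved by `A` if `U` is abelian, so for `F ∈ A` the
pairs `(y, b)` with `F b y = y` are counted orbit by orbit. -/
theorem natCard_fixed_pairs [Finite G] [Finite U] (hU : ∀ u u' : U, u * u' = u' * u) (x : X)
    (A : Subgroup U) (hA : ∀ u, u ∈ A ↔ ∃ g : G, u • x = g • x) {F : U} (hF : F ∈ A) :
    Nat.card {p : X × G // (∃ (g : G) (u : U), g • u • x = p.1) ∧ F • p.2 • p.1 = p.1} =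
      Nat.card G * A.index := by
  let _ : MulAction (G × U) X := MulAction.prodOfSMulCommClass G U X
  have horb : ∀ y, (∃ (g : G) (u : U), g • u • x = y) ↔ y ∈ MulAction.orbit (G × U) x := fun y =>
    ⟨fun ⟨g, u, h⟩ => ⟨(g, u), h⟩, fun ⟨p, h⟩ => ⟨p.1, p.2, h⟩⟩
  obtain ⟨h, hh⟩ := (hA F⁻¹).1 (inv_mem hF)
  have hrep : ∀ y : MulAction.orbit (G × U) x, ∃ (g : G) (u : U), g • u • x = y := fun y =>
    (horb y).2 y.2
  choose r t hrt using hrep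
  -- `F b y = y` is a condition on the coset of `r⁻¹ b r` modulo the stabilizer of `x`
  have key : ∀ (y : MulAction.orbit (G × U) x) (b : G), F • b • (y : X) = y ↔
      (h⁻¹ * (r y)⁻¹ * b * r y) • x = x := by
    intro y b
    have h1 : F • b • (y : X) = t y • F • (b * r y) • x := by
      conv_lhs => rw [← hrt y]
      rw [← mul_smul b, smul_comm (b * r y) (t y), ← mul_smul, hU, mul_smul]
    have h2 : (y : X) = t y • r y • x := by rw [← hrt y, smul_comm]
    rw [h1]
    conv_lhs => rw [h2]
    rw [smul_left_cancel_iff, ← eq_inv_smul_iff, ← smul_comm (r y) F⁻¹, hh, mul_assoc, mul_assoc,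
      mul_smul h⁻¹, inv_smul_eq_iff, mul_smul (r y)⁻¹, inv_smul_eq_iff]
  have e1 : Nat.card {p : X × G // (∃ (g : G) (u : U), g • u • x = p.1) ∧ F • p.2 • p.1 = p.1} =
      Nat.card (MulAction.orbit (G × U) x) * Nat.card (MulAction.stabilizer G x) := by
    rw [← Nat.card_prod]
    refine Nat.card_congr ?_
    exact
      { toFun := fun p => (⟨p.1.1, (horb _).1 p.2.1⟩,
          ⟨_, (key ⟨p.1.1, (horb _).1 p.2.1⟩ p.1.2).1 p.2.2⟩)
        invFun := fun p => ⟨(p.1, r p.1 * h * p.2 * (r p.1)⁻¹), (horb _).2 p.1.2,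
          (key p.1 _).2 (by
            have : h⁻¹ * (r p.1)⁻¹ * (r p.1 * h * p.2 * (r p.1)⁻¹) * r p.1 = p.2 := by group
            rw [this]
            exact p.2.2)⟩
        left_inv := fun p => by
          refine Subtype.ext (Prod.ext rfl ?_)
          simp [mul_assoc]
        right_inv := fun p => by
          refine Prod.ext rfl (Subtype.ext ?_)
          simp [mul_assoc] }
  have e2 : Nat.card (MulAction.orbit (G × U) x) *
      (Nat.card A * Nat.card (MulAction.stabilizer G x)) = Nat.card G * Nat.card U := by
    rw [← natCard_stabilizer_prod x A hA, ← Nat.card_prod G U,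
      Nat.card_congr (MulAction.orbitEquivQuotientStabilizer (G × U) x)]
    exact (Subgroup.card_eq_card_quotient_mul_card_subgroup _).symm
  have e3 := A.card_mul_index
  have hA0 : Nat.card A ≠ 0 := Nat.card_pos.ne'
  rw [e1]
  refine Nat.eq_of_mul_eq_mul_left (Nat.pos_of_ne_zero hA0) ?_
  rw [← e3] at e2
  calc _ = _ := by ring
    _ = _ := e2
    _ = _ := by ring

theorem isEmpty_fixed_pairs (hU : ∀ u u' : U, u * u' = u' * u) (x : X)
    (A : Subgroup U) (hA : ∀ u, u ∈ A ↔ ∃ g : G, u • x = g • x) {F : U} (hF : F ∉ A) :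
    IsEmpty {p : X × G // (∃ (g : G) (u : U), g • u • x = p.1) ∧ F • p.2 • p.1 = p.1} := by
  refine ⟨fun ⟨⟨y, b⟩, ⟨g, u, hy⟩, hb⟩ => hF ?_⟩
  rw [← inv_mem_iff]
  refine (hA _).2 ⟨g⁻¹ * b * g, ?_⟩
  dsimp only at hy hb
  subst hy
  have h1 : b • g • x = F⁻¹ • g • x := by
    refine smul_left_cancel u ?_
    calc u • b • g • x = b • g • u • x := by rw [smul_comm g u, smul_comm b u]
      _ = F⁻¹ • g • u • x := by rw [eq_inv_smul_iff]; exact hb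
      _ = u • F⁻¹ • g • x := by rw [smul_comm g u, ← mul_smul, hU, mul_smul]
  rw [mul_smul, mul_smul, h1, ← smul_comm g F⁻¹, inv_smul_smul]

end Counting

/-! ### Inertia pairs of local homomorphisms -/

namespace InertiaPair

variable {K : Type*} [Field K] {G : Type*} [Group G] {e : ℕ}

theorem γ_eq_of_eq {x y : InertiaPair K G e} (h : x = y) {g : G} (hx : g ∈ x.I) (hy : g ∈ y.I) :
    x.γ ⟨g, hx⟩ = y.γ ⟨g, hy⟩ := by
  subst h
  rfl

theorem galois_smul_γ (u : Gal(CyclotomicField e K/K)) (x : InertiaPair K G e) (g : x.I) :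
    ((((u • x).γ g : rootsOfUnity e (CyclotomicField e K)) : (CyclotomicField e K)ˣ) :
      CyclotomicField e K) = u ((x.γ g : (CyclotomicField e K)ˣ) : CyclotomicField e K) := rfl

theorem mem_smul_I (g : G) (x : InertiaPair K G e) (a : G) :
    a ∈ (g • x).I ↔ g⁻¹ * a * g ∈ x.I := by
  refine (mem_conj_I g x a).trans ⟨?_, fun h => ⟨⟨_, h⟩, by simp [mul_assoc]⟩⟩
  rintro ⟨h, rfl⟩
  simp [mul_assoc]

theorem smul_γ (g : G) (x : InertiaPair K G e) (a : G) (ha : a ∈ (g • x).I) :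
    (g • x).γ ⟨a, ha⟩ = x.γ ⟨g⁻¹ * a * g, (mem_smul_I g x a).1 ha⟩ := by
  obtain ⟨h, rfl⟩ := (mem_conj_I g x a).1 ha
  refine (conj_γ g x h ha).trans (congrArg x.γ (Subtype.ext ?_))
  simp [mul_assoc]

theorem mem_orbitStabilizer (x : InertiaPair K G e) (u : Gal(CyclotomicField e K/K)) :
    u ∈ x.orbitStabilizer ↔ ∃ g : G, u • x = g • x := by
  rw [orbitStabilizer, MulAction.mem_stabilizer_iff]
  refine (Quotient.eq'' (s₁ := MulAction.orbitRel G (InertiaPair K G e))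
    (a := u • x) (b := x)).trans ?_
  exact ⟨fun ⟨g, h⟩ => ⟨g, h.symm⟩, fun ⟨g, h⟩ => ⟨g, h.symm⟩⟩

theorem ramificationType_eq_iff (x y : InertiaPair K G e) :
    y.ramificationType = x.ramificationType ↔
      ∃ (g : G) (u : Gal(CyclotomicField e K/K)), g • u • x = y := by
  refine (Quotient.eq'' (s₁ := MulAction.orbitRel (G × Gal(CyclotomicField e K/K))
    (InertiaPair K G e)) (a := y) (b := x)).trans ?_
  exact ⟨fun ⟨p, h⟩ => ⟨p.1, p.2, h⟩, fun ⟨g, u, h⟩ => ⟨(g, u), h⟩⟩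

end InertiaPair

section Frobenius

variable {K : Type*} [Field K] [NumberField K] {e : ℕ} [NeZero e] {v : HeightOneSpectrum (𝓞 K)}

/-- A Frobenius automorphism at a prime not dividing `e` raises the `e`-th roots of unity to the
power `q`. -/
theorem IsFrobenius.apply_rootOfUnity (hv : (e : 𝓞 K) ∉ v.asIdeal)
    {Frob : Gal(CyclotomicField e K/K)} (hFrob : IsFrobenius v Frob) {c : CyclotomicField e K}
    (hc : c ^ e = 1) : Frob c = c ^ Nat.card (𝓞 K ⧸ v.asIdeal) := by
  obtain ⟨P, -, hover, harith⟩ := hFrob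
  have hint : IsIntegral ℤ c := ⟨Polynomial.X ^ e - 1, Polynomial.monic_X_pow_sub_C 1 (NeZero.ne e),
    by simp [hc]⟩
  set z : 𝓞 (CyclotomicField e K) := ⟨c, hint⟩ with hz
  have hze : z ^ e = 1 := Subtype.ext hc
  have heP : (e : 𝓞 (CyclotomicField e K)) ∉ P := by
    intro h
    apply hv
    rw [hover.over, Ideal.mem_comap, map_natCast]
    exact h
  have h1 := harith.apply_of_pow_eq_one hze heP
  rw [← hover.over] at h1
  have h2 := algebraMap_galRestrict_apply (𝓞 K) Frob z
  have h3 := congrArg (algebraMap (𝓞 (CyclotomicField e K)) (CyclotomicField e K)) h1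
  rw [map_pow] at h3
  exact h2.symm.trans h3

omit [NeZero e] in
/-- Two embeddings of `K(μ_e)` over `K` differ by an automorphism of `K(μ_e)`. -/
theorem exists_algHom_eq_comp {Ω : Type*} [Field Ω] [Algebra K Ω]
    (ι ι' : CyclotomicField e K →ₐ[K] Ω) :
    ∃ u : Gal(CyclotomicField e K/K), ∀ c, ι' c = ι (u c) := by
  let _ : Algebra (CyclotomicField e K) Ω := ι.toRingHom.toAlgebra
  have : IsScalarTower K (CyclotomicField e K) Ω :=
    IsScalarTower.of_algebraMap_eq fun a => (ι.commutes a).symm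
  have : IsGalois K (CyclotomicField e K) := IsCyclotomicExtension.isGalois {e} K _
  refine ⟨Normal.algHomEquivAut K Ω (CyclotomicField e K) ι', fun c => ?_⟩
  have h := (Normal.algHomEquivAut K Ω (CyclotomicField e K)).symm_apply_apply ι'
  conv_lhs => rw [← h]
  rfl

end Frobenius

section Local

variable {K : Type*} [Field K] [NumberField K] {v : HeightOneSpectrum (𝓞 K)}
  {G : Type*} [Group G] [TopologicalSpace G] {e : ℕ}

theorem hasInertiaPair_comp {f : LocalGaloisGroup v →ₜ* G}
    {ι ι' : CyclotomicField e K →ₐ[K] LocalClosure v} {u : Gal(CyclotomicField e K/K)}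
    (h : ∀ c, ι' c = ι (u c)) {x : InertiaPair K G e} (hx : HasInertiaPair f ι' x) :
    HasInertiaPair f ι (u • x) := by
  refine ⟨hx.1, hx.2.1, fun σ hσ π hπ g hg => ?_⟩
  obtain ⟨m, hm, hxm⟩ := hx.2.2 σ hσ π hπ g hg
  refine ⟨m, hm, ?_⟩
  rw [h] at hxm
  exact hxm

theorem hasRamificationType_iff [NeZero e] (f : LocalGaloisGroup v →ₜ* G)
    (ι : CyclotomicField e K →ₐ[K] LocalClosure v) (x : InertiaPair K G e) :
    HasRamificationType f x.ramificationType ↔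
      ∃ y : InertiaPair K G e, (∃ (g : G) (u : Gal(CyclotomicField e K/K)), g • u • x = y) ∧
        HasInertiaPair f ι y := by
  constructor
  · rintro ⟨ι', y, hy, hyx⟩
    obtain ⟨u, hu⟩ := exists_algHom_eq_comp ι ι'
    obtain ⟨g, t, rfl⟩ := (InertiaPair.ramificationType_eq_iff x y).1 hyx
    refine ⟨u • g • t • x, ⟨g, u * t, ?_⟩, hasInertiaPair_comp hu hy⟩
    rw [mul_smul, smul_comm g u]
  · rintro ⟨y, hyx, hy⟩
    exact ⟨ι, y, hy, (InertiaPair.ramificationType_eq_iff x y).2 hyx⟩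

variable [Finite G] [DiscreteTopology G] [NeZero e] {β : LocalClosure v}
  (hβ : β ^ e = algebraMap _ (LocalClosure v) (localValuation v).ϖ) (hv : (e : 𝓞 K) ∉ v.asIdeal)

include hβ hv

/-- The uniformizer of the field cut out by `f` may be replaced by `β`: if `f` has inertia group of
order `e`, then the ramification index is `e`, so both have the same valuation. -/
theorem hasInertiaPair_iff (f : LocalGaloisGroup v →ₜ* G)
    (ι : CyclotomicField e K →ₐ[K] LocalClosure v) (x : InertiaPair K G e) :
    HasInertiaPair f ι x ↔ x.I = (localInertia v).map f.toMonoidHom ∧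
      ∀ σ ∈ (localValuation v).inertia, ∀ g : x.I, (g : G) = f σ →
        σ β = ι ((x.γ g : (CyclotomicField e K)ˣ) : CyclotomicField e K) * β := by
  set W := localValuation v with hW
  have he0 : e ≠ 0 := NeZero.ne e
  have he : W.w (e : LocalClosure v) = 1 := localValuation_natCast_eq_one v hv
  have hβ0 := W.ne_zero_of_pow_eq_ϖ hβ he0
  have hγe : ∀ g : x.I, ι ((x.γ g : (CyclotomicField e K)ˣ) : CyclotomicField e K) ^ e = 1 := by
    intro g
    have := (mem_rootsOfUnity' e _).1 (x.γ g).2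
    rw [← map_pow, this, map_one]
  have hcard : x.I = (localInertia v).map f.toMonoidHom →
      Nat.card (W.inertia.map f.toMonoidHom) = e := fun h => by
    rw [hW, ← localInertia_eq, ← h, x.card_eq]
  constructor
  · rintro ⟨-, hI, hπ⟩
    refine ⟨hI, fun σ hσ g hg => ?_⟩
    obtain ⟨π, hirr⟩ := exists_uniformizer_kernelField f
    have hcong : ∀ σ ∈ W.inertia, ∀ g : x.I, (g : G) = f σ →
        W.w (ι ((x.γ g : (CyclotomicField e K)ˣ) : CyclotomicField e K) -
          σ ((π : kernelField f) : LocalClosure v) / ((π : kernelField f) : LocalClosure v)) < 1 := by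
      intro σ hσ g hg
      obtain ⟨m, hm, h⟩ := hπ σ (by rwa [localInertia_eq]) π hirr g hg
      exact (exists_mem_maximalIdeal_iff v _).1 ⟨m, hm, h⟩
    obtain ⟨k, hk⟩ := exists_localValuation_ϖ_eq_pow hirr
    have hζ := IsCyclotomicExtension.zeta_spec e K (CyclotomicField e K)
    obtain ⟨g₀, hg₀⟩ := x.γ.surjective hζ.toRootsOfUnity
    obtain ⟨σ₀, hσ₀, hσg₀⟩ : (g₀ : G) ∈ (localInertia v).map f.toMonoidHom := hI ▸ g₀.2
    rw [SetLike.mem_coe, localInertia_eq] at hσ₀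
    -- `ζ ≡ σ₀ π / π` for a primitive `e`-th root of unity `ζ`, so `e` divides the ramification
    -- index `k`
    have hek : e ∣ k := by
      refine W.dvd_of_isPrimitiveRoot he hσ₀ hk ?_ (hcong σ₀ hσ₀ g₀ hσg₀.symm)
      rw [hg₀]
      exact hζ.map_of_injective ι.injective
    have hwπ := W.w_pow_eq_of_dvd f.toMonoidHom (hcard hI) (π : kernelField f).2
      (localValuation_uniformizer_lt_one hirr) hk hek
    have h1 := W.div_sub_div_lt_one hβ he0 hwπ hσ
    rw [← W.w.rootOfUnity_eq_of_sub_lt_one he (W.div_pow_eq_one hβ σ) (hγe g)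
      (W.w.sub_lt_one_symm (W.w.sub_lt_one_trans (hcong σ hσ g hg) h1)), div_mul_cancel₀ _ hβ0]
  · rintro ⟨hI, h⟩
    refine ⟨hv, hI, fun σ hσ π hirr g hg => ?_⟩
    rw [localInertia_eq] at hσ
    rw [exists_mem_maximalIdeal_iff]
    obtain ⟨k, hk⟩ := exists_localValuation_ϖ_eq_pow hirr
    have hπ1 := localValuation_uniformizer_lt_one hirr
    have hek : e ∣ k := by
      -- `β` is unramified over the field cut out by `f`
      obtain ⟨z, hz, hzβ⟩ := W.exists_mem_w_eq_of_fixed (kernelField f) (y := β) fun τ hτ hτf => by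
        rw [fixingSubgroup_kernelField] at hτf
        have h1 := h τ hτ 1 (Eq.symm hτf)
        rwa [map_one, Subgroup.coe_one, Units.val_one, map_one, one_mul] at h1
      have hwβ : W.w β ≠ 0 := by rwa [Valuation.ne_zero_iff]
      have hz0 : z ≠ 0 := by rwa [← Valuation.ne_zero_iff W.w, hzβ]
      obtain ⟨i, hi⟩ := exists_localValuation_eq_zpow hirr hz hz0
      have hπpos : 0 < W.w ((π : kernelField f) : LocalClosure v) := by
        rw [pos_iff_ne_zero]
        intro h0
        have hϖ := W.w_ϖ_pos
        rw [hk, h0] at hϖ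
        have hk0 : k = 0 := by
          by_contra hk0
          rw [zero_pow hk0] at hϖ
          exact lt_irrefl _ hϖ
        have hϖ1 := W.w_ϖ_lt_one
        rw [hk, hk0, pow_zero] at hϖ1
        exact lt_irrefl _ hϖ1
      rw [← hβ, map_pow, ← hzβ, hi, ← zpow_natCast, ← zpow_natCast, ← zpow_mul] at hk
      have h2 : i * (e : ℤ) = k := zpow_right_injective₀ hπpos hπ1.ne hk
      exact Int.natCast_dvd_natCast.1 ⟨i, by rw [← h2, mul_comm]⟩
    have hwπ := W.w_pow_eq_of_dvd f.toMonoidHom (hcard hI) (π : kernelField f).2 hπ1 hk hek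
    have h1 := W.div_sub_div_lt_one hβ he0 hwπ hσ
    rw [h σ hσ g hg, mul_div_cancel_right₀ _ hβ0] at h1
    exact W.w.sub_lt_one_symm h1

end Local

/-! ### Counting local homomorphisms -/

section Local

variable {K : Type*} [Field K] [NumberField K] {v : HeightOneSpectrum (𝓞 K)}
  {G : Type*} [Group G] [TopologicalSpace G] [Finite G] [DiscreteTopology G] {e : ℕ} [NeZero e]
  {β : LocalClosure v}
  (hβ : β ^ e = algebraMap _ (LocalClosure v) (localValuation v).ϖ) (hv : (e : 𝓞 K) ∉ v.asIdeal)
  {f f' : LocalGaloisGroup v →ₜ* G} {ι : CyclotomicField e K →ₐ[K] LocalClosure v}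
  {x y : InertiaPair K G e}

include hβ hv

/-- The inertia pair of a homomorphism is determined by the embedding of `K(μ_e)`. -/
theorem HasInertiaPair.unique (hx : HasInertiaPair f ι x) (hy : HasInertiaPair f ι y) : x = y := by
  have hβ0 := (localValuation v).ne_zero_of_pow_eq_ϖ hβ (NeZero.ne e)
  obtain ⟨hI, h⟩ := (hasInertiaPair_iff hβ hv f ι x).1 hx
  obtain ⟨hI', h'⟩ := (hasInertiaPair_iff hβ hv f ι y).1 hy
  refine InertiaPair.ext' (hI.trans hI'.symm) fun g hgx hgy => ?_
  obtain ⟨σ, hσ, hσg⟩ : g ∈ (localInertia v).map f.toMonoidHom := hI ▸ hgx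
  rw [SetLike.mem_coe, localInertia_eq] at hσ
  have h1 := (h σ hσ ⟨g, hgx⟩ hσg.symm).symm.trans (h' σ hσ ⟨g, hgy⟩ hσg.symm)
  exact Subtype.ext (Units.ext (ι.injective (mul_right_cancel₀ hβ0 h1)))

/-- A homomorphism is determined by its inertia pair and its value at a Frobenius automorphism. -/
theorem HasInertiaPair.hom_ext {s : LocalGaloisGroup v}
    (hs : ∀ z, (localValuation v).w z ≤ 1 →
      (localValuation v).w (s z - z ^ (localValuation v).q) < 1)
    (hf : HasInertiaPair f ι x) (hf' : HasInertiaPair f' ι x) (h : f s = f' s) : f = f' := by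
  have hβ0 := (localValuation v).ne_zero_of_pow_eq_ϖ hβ (NeZero.ne e)
  obtain ⟨hI, hγ⟩ := (hasInertiaPair_iff hβ hv f ι x).1 hf
  obtain ⟨hI', hγ'⟩ := (hasInertiaPair_iff hβ hv f' ι x).1 hf'
  have htop := (localValuation v).eq_top_of_isClosed hs
    (H := f.toMonoidHom.eqLocus f'.toMonoidHom)
    (isClosed_eq f.continuous_toFun f'.continuous_toFun) (fun σ hσ => ?_) h
  · refine DFunLike.ext _ _ fun σ => ?_
    have : σ ∈ f.toMonoidHom.eqLocus f'.toMonoidHom := htop ▸ Subgroup.mem_top σ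
    exact this
  · have hσ' : σ ∈ localInertia v := by rwa [localInertia_eq]
    have hmem : f σ ∈ x.I := hI ▸ Subgroup.mem_map_of_mem _ hσ'
    have hmem' : f' σ ∈ x.I := hI' ▸ Subgroup.mem_map_of_mem _ hσ'
    have h1 := (hγ σ hσ ⟨_, hmem⟩ rfl).symm.trans (hγ' σ hσ ⟨_, hmem'⟩ rfl)
    have h2 : x.γ ⟨_, hmem⟩ = x.γ ⟨_, hmem'⟩ :=
      Subtype.ext (Units.ext (ι.injective (mul_right_cancel₀ hβ0 h1)))
    exact congrArg Subtype.val (x.γ.injective h2)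

variable {Frob : Gal(CyclotomicField e K/K)} (hFrob : IsFrobenius v Frob)
  {s : LocalGaloisGroup v} (hs : ∀ z, (localValuation v).w z ≤ 1 →
      (localValuation v).w (s z - z ^ (localValuation v).q) < 1) (hsβ : s β = β)

include hFrob hs hsβ

/-- Conjugation by a Frobenius automorphism acts on tame inertia through the cyclotomic
character. -/
theorem HasInertiaPair.frobenius_smul (hf : HasInertiaPair f ι y) : Frob • f s • y = y := by
  have he0 : e ≠ 0 := NeZero.ne e
  have he : (localValuation v).w (e : LocalClosure v) = 1 := localValuation_natCast_eq_one v hv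
  obtain ⟨hI, hγ⟩ := (hasInertiaPair_iff hβ hv f ι y).1 hf
  have hmem : ∀ g : G, f s * g * (f s)⁻¹ ∈ y.I ↔ g ∈ y.I := by
    intro g
    rw [hI]
    constructor
    · rintro ⟨σ, hσ, hσg⟩
      rw [SetLike.mem_coe, localInertia_eq] at hσ
      have h1 := (localValuation v).conj_mem_inertia s⁻¹ hσ
      rw [← localInertia_eq] at h1
      refine ⟨_, h1, ?_⟩
      have hσg' : f σ = f s * g * (f s)⁻¹ := hσg
      change f (s⁻¹ * σ * s⁻¹⁻¹) = g
      rw [map_mul, map_mul, hσg', inv_inv, map_inv]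
      group
    · rintro ⟨σ, hσ, hσg⟩
      rw [SetLike.mem_coe, localInertia_eq] at hσ
      have h1 := (localValuation v).conj_mem_inertia s hσ
      rw [← localInertia_eq] at h1
      refine ⟨_, h1, ?_⟩
      have hσg' : f σ = g := hσg
      change f (s * σ * s⁻¹) = _
      rw [map_mul, map_mul, hσg', map_inv]
  refine HasInertiaPair.unique hβ hv (f := f) (ι := ι) ?_ hf
  rw [hasInertiaPair_iff hβ hv]
  have hII : (Frob • f s • y).I = y.I := by
    ext g
    change g ∈ (f s • y).I ↔ _
    rw [InertiaPair.mem_smul_I, ← hmem]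
    simp [mul_assoc]
  refine ⟨hII.trans hI, fun σ hσ g hg => ?_⟩
  rw [InertiaPair.galois_smul_γ]
  have hτ := (localValuation v).conj_mem_inertia s⁻¹ hσ
  have hgmem : (g : G) ∈ (f s • y).I := g.2
  have h1 : (f s • y).γ ⟨g, hgmem⟩ =
      y.γ ⟨(f s)⁻¹ * g * f s, (InertiaPair.mem_smul_I _ _ _).1 hgmem⟩ :=
    InertiaPair.smul_γ _ _ _ _
  have h2 := hγ _ hτ ⟨(f s)⁻¹ * g * f s, (InertiaPair.mem_smul_I _ _ _).1 hgmem⟩ (by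
    change (f s)⁻¹ * (g : G) * f s = _
    rw [hg, inv_inv, map_mul, map_mul, map_inv])
  have h3 : (f s • y).γ g = (f s • y).γ ⟨g, hgmem⟩ := rfl
  change σ β = ι (Frob (((f s • y).γ g : (CyclotomicField e K)ˣ) : CyclotomicField e K)) * β
  rw [h3, h1]
  set c := y.γ ⟨(f s)⁻¹ * g * f s, (InertiaPair.mem_smul_I _ _ _).1 hgmem⟩ with hc
  have hce : ((c : (CyclotomicField e K)ˣ) : CyclotomicField e K) ^ e = 1 :=
    (mem_rootsOfUnity' e _).1 c.2
  rw [IsFrobenius.apply_rootOfUnity hv hFrob hce, map_pow, ← localValuation_q,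
    ← (localValuation v).frobenius_rootOfUnity hs he (by rw [← map_pow, hce, map_one])]
  have h4 := congrArg s h2
  rwa [map_mul, hsβ, inv_inv, ← AlgEquiv.mul_apply, ← mul_assoc, mul_inv_cancel_left,
    AlgEquiv.mul_apply, hsβ] at h4

/-- A pair `y` and an element `b` compatible with the action of Frobenius on tame inertia come from
a homomorphism. -/
theorem exists_hasInertiaPair {b : G} (hy : Frob • b • y = y)
    (ι : CyclotomicField e K →ₐ[K] LocalClosure v) :
    ∃ f : LocalGaloisGroup v →ₜ* G, HasInertiaPair f ι y ∧ f s = b := by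
  have he0 : e ≠ 0 := NeZero.ne e
  have he : (localValuation v).w (e : LocalClosure v) = 1 := localValuation_natCast_eq_one v hv
  have hβ0 := (localValuation v).ne_zero_of_pow_eq_ϖ hβ he0
  have hζ := IsCyclotomicExtension.zeta_spec e K (CyclotomicField e K)
  have hιζ : IsPrimitiveRoot (ι (IsCyclotomicExtension.zeta e K (CyclotomicField e K))) e :=
    hζ.map_of_injective ι.injective
  set Z := hζ.toRootsOfUnity with hZ
  set a : y.I := y.γ.symm Z with ha
  have hγa : y.γ a = Z := y.γ.apply_symm_apply Z
  have hγai : ∀ i : ℕ, ι ((y.γ (a ^ i) : (CyclotomicField e K)ˣ) : CyclotomicField e K) =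
      ι (IsCyclotomicExtension.zeta e K (CyclotomicField e K)) ^ i := by
    intro i
    rw [map_pow, hγa, ← map_pow]
    rfl
  have hae : (a : G) ^ e = 1 := by
    have h1 : a ^ e = 1 :=
      orderOf_dvd_iff_pow_eq_one.1 ((orderOf_dvd_natCard a).trans y.card_eq.dvd)
    rw [← Subgroup.coe_pow, h1, Subgroup.coe_one]
  have hab : b * a * b⁻¹ = (a : G) ^ (localValuation v).q := by
    have hmem : b * a * b⁻¹ ∈ (Frob • b • y).I := by
      change _ ∈ (b • y).I
      rw [InertiaPair.mem_smul_I]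
      simp [mul_assoc]
    have hmem' : b * a * b⁻¹ ∈ y.I := by rwa [hy] at hmem
    have h1 := InertiaPair.γ_eq_of_eq hy hmem hmem'
    have h2 : y.γ ⟨b * a * b⁻¹, hmem'⟩ = y.γ (a ^ (localValuation v).q) := by
      rw [← h1]
      refine Subtype.ext (Units.ext ?_)
      rw [InertiaPair.galois_smul_γ]
      have h3 : (b • y).γ ⟨b * a * b⁻¹, hmem⟩ = y.γ a :=
        (InertiaPair.smul_γ b y _ _).trans (congrArg y.γ (Subtype.ext (by simp [mul_assoc])))
      have hce : ((y.γ a : (CyclotomicField e K)ˣ) : CyclotomicField e K) ^ e = 1 :=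
        (mem_rootsOfUnity' e _).1 (y.γ a).2
      rw [map_pow, localValuation_q]
      refine Eq.trans (congrArg (fun c : rootsOfUnity e (CyclotomicField e K) =>
        Frob ((c : (CyclotomicField e K)ˣ) : CyclotomicField e K)) h3) ?_
      exact IsFrobenius.apply_rootOfUnity hv hFrob hce
    exact congrArg Subtype.val (y.γ.injective h2)
  -- so `a` and `b` satisfy the defining relations of the tame quotient
  obtain ⟨f, hfs, hf⟩ := (localValuation v).exists_continuousMonoidHom hβ he hιζ hs hsβ hae hab
  refine ⟨f, (hasInertiaPair_iff hβ hv f ι y).2 ⟨?_, fun σ hσ g hg => ?_⟩, hfs⟩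
  · ext g
    constructor
    · intro hg
      obtain ⟨i, -, hi⟩ := hζ.eq_pow_of_pow_eq_one
        (ξ := ((y.γ ⟨g, hg⟩ : (CyclotomicField e K)ˣ) : CyclotomicField e K))
        ((mem_rootsOfUnity' e _).1 (y.γ ⟨g, hg⟩).2)
      have hga : (⟨g, hg⟩ : y.I) = a ^ i := by
        refine y.γ.injective (Subtype.ext (Units.ext ?_))
        rw [map_pow, hγa]
        exact hi.symm
      obtain ⟨τ, hτ, hτβ⟩ := (localValuation v).exists_inertia_eq_mul hβ he
        (ζ := ι (IsCyclotomicExtension.zeta e K (CyclotomicField e K)) ^ i)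
        (by rw [← pow_mul, mul_comm, pow_mul, hιζ.pow_eq_one, one_pow])
      rw [← localInertia_eq] at hτ
      refine ⟨τ, hτ, ?_⟩
      change f τ = g
      rw [localInertia_eq] at hτ
      rw [hf τ hτ i hτβ]
      exact (congrArg Subtype.val hga).symm
    · rintro ⟨σ, hσ, rfl⟩
      rw [SetLike.mem_coe, localInertia_eq] at hσ
      obtain ⟨i, -, hi⟩ := hιζ.eq_pow_of_pow_eq_one ((localValuation v).div_pow_eq_one hβ σ)
      change f σ ∈ y.I
      rw [hf σ hσ i (by rw [hi, div_mul_cancel₀ _ hβ0])]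
      exact pow_mem a.2 i
  · obtain ⟨i, -, hi⟩ := hιζ.eq_pow_of_pow_eq_one ((localValuation v).div_pow_eq_one hβ σ)
    have hσβ : σ β = ι (IsCyclotomicExtension.zeta e K (CyclotomicField e K)) ^ i * β := by
      rw [hi, div_mul_cancel₀ _ hβ0]
    rw [hf σ hσ i hσβ] at hg
    have hga : g = a ^ i := Subtype.ext hg
    rw [hga, hγai, hσβ]

end Local

open Classical in
theorem mainTheorem6 {K : Type*} [Field K] [NumberField K]
    {G : Type*} [Group G] [Finite G] [TopologicalSpace G] [DiscreteTopology G]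
    {e : ℕ} (x : InertiaPair K G e) (v : HeightOneSpectrum (𝓞 K)) (hv : (e : 𝓞 K) ∉ v.asIdeal)
    (Frob : Gal(CyclotomicField e K/K)) (hFrob : IsFrobenius v Frob) :
    {f : LocalGaloisGroup v →ₜ* G | HasRamificationType f x.ramificationType}.Finite ∧
    1 / (Nat.card G : ℚ) *
        ({f : LocalGaloisGroup v →ₜ* G | HasRamificationType f x.ramificationType}.ncard : ℚ) =
      if Frob ∈ x.orbitStabilizer then (x.orbitStabilizer.index : ℚ) else 0 := by
  have : NeZero e := ⟨by rw [← x.card_eq]; exact Nat.card_pos.ne'⟩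
  have he : (localValuation v).w (e : LocalClosure v) = 1 := localValuation_natCast_eq_one v hv
  obtain ⟨β, hβ⟩ := IsAlgClosed.exists_pow_nat_eq
    (algebraMap _ (LocalClosure v) (localValuation v).ϖ) (Nat.pos_of_ne_zero (NeZero.ne e))
  obtain ⟨s, hs, hsβ⟩ := (localValuation v).exists_frobenius_fixing hβ he
  let ι : CyclotomicField e K →ₐ[K] LocalClosure v := IsAlgClosed.lift
  set S := {f : LocalGaloisGroup v →ₜ* G | HasRamificationType f x.ramificationType} with hS
  set T := {p : InertiaPair K G e × G //
    (∃ (g : G) (u : Gal(CyclotomicField e K/K)), g • u • x = p.1) ∧ Frob • p.2 • p.1 = p.1} with hT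
  -- the bijection sends `(y, b)` to the homomorphism with inertia pair `y` and value `b` at `s`
  choose F hF hFs using fun p : T => exists_hasInertiaPair hβ hv hFrob hs hsβ p.2.2 ι
  let Φ : T → S := fun p => ⟨F p, (hasRamificationType_iff (F p) ι x).2 ⟨p.1.1, p.2.1, hF p⟩⟩
  have hΦ : Function.Bijective Φ := by
    constructor
    · intro p p' h
      have hFF : F p = F p' := congrArg Subtype.val h
      have h1 := hF p'
      rw [← hFF] at h1
      refine Subtype.ext (Prod.ext (HasInertiaPair.unique hβ hv (hF p) h1) ?_)
      rw [← hFs p, ← hFs p', hFF]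
    · rintro ⟨f, hf⟩
      obtain ⟨y, hyx, hy⟩ := (hasRamificationType_iff f ι x).1 hf
      refine ⟨⟨(y, f s), hyx, HasInertiaPair.frobenius_smul hβ hv hFrob hs hsβ hy⟩, ?_⟩
      exact Subtype.ext (HasInertiaPair.hom_ext hβ hv hs (hF _) hy (hFs _))
  have hcard : S.ncard = Nat.card T := (Nat.card_congr (Equiv.ofBijective Φ hΦ)).symm
  have hcomm := IsCyclotomicExtension.isMulCommutative {e} K (CyclotomicField e K)
  have hU : ∀ u u' : Gal(CyclotomicField e K/K), u * u' = u' * u := hcomm.is_comm.comm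
  have hfinT : Finite T := by
    refine Finite.of_injective (β := (Set.range fun p : G × Gal(CyclotomicField e K/K) =>
      p.1 • p.2 • x) × G) (fun p => (⟨p.1.1, ?_⟩, p.1.2)) ?_
    · obtain ⟨g, u, h⟩ := p.2.1
      exact ⟨(g, u), h⟩
    · intro p p' h
      exact Subtype.ext (Prod.ext (congrArg Subtype.val (Prod.ext_iff.1 h).1)
        (Prod.ext_iff.1 h).2)
  have hfinS : Finite S := Finite.of_surjective Φ hΦ.2
  refine ⟨S.toFinite, ?_⟩
  rw [hcard]
  split_ifs with hmem
  · rw [hT, natCard_fixed_pairs hU x _ x.mem_orbitStabilizer hmem]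
    have hG : (Nat.card G : ℚ) ≠ 0 := Nat.cast_ne_zero.2 Nat.card_pos.ne'
    push_cast
    field_simp
  · have := isEmpty_fixed_pairs hU x _ x.mem_orbitStabilizer hmem
    have h0 : Nat.card T = 0 := Nat.card_of_isEmpty
    rw [h0, Nat.cast_zero, mul_zero]
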